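/- Conventions. A valuation of a field $K$ is a map $v\colon K\smallsetminus\{0\}\to\mathbb R$ which is either a homomorphism with $v(a+b)\ge\min(v(a),v(b))$, or of the form $v(a)=-c\log|\sigma(a)|$ for a ring homomorphism $\sigma\colon K\to\mathbb C$ and some $c>0$; the set of valuations carries the topology of pointwise convergence. A globally valued field (GVF) structure on $K$ is a Borel measure $\mu_K$ on the space of valuations of $K$, concentrated on a Borel set $\Pi$ of nontrivial, pairwise inequivalent valuations (equivalent means differing by a positive factor), such that for every $a\in K\smallsetminus\{0\}$ the function $v\mapsto v(a)$ is integrable and $\int v(a)\,d\mu_K(v)=0$. A GVF structure $\nu$ on an extension field $F$ extends $\mu_K$ if restriction to $K$ pushes the restriction of $\nu$ to the valuations nontrivial on $K$ forward to $\mu_K$. Let $K$ be a countable field with a GVF structure $(\Pi,\mu_K)$. Let $X\subset\mathbb P^n_K$ be an irreducible closed subvariety not contained in the hyperplane $T_0=0$, let $D$ be the (very ample) divisor cut out on $X$ by $T_0=0$, let $x_i=T_i/T_0\in K(X)$, and let $X_{\mathrm{aff}}=X\smallsetminus D$, with coordinate ring $K[x]=K[x_1,\dots,x_n]$. Let $L(mD)$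 be the space of $f\in K(X)$ with poles at most $mD$; it is contained in $K[x]$. The Berkovich space $X_{\mathrm{aff}}^{\mathrm{an}}$ is the set of all semivaluations $v\colon K[x]\to\mathbb R\cup\{+\infty\}$, defined in the same two ways (with a ring homomorphism $\sigma\colon K[x]\to\mathbb C$ in the second), again with the topology of pointwise convergence; such a $v$ lies above $p$ if $v|_K=p$. Let $S\subset\Pi$ be compact, and let $A$ be a $D$-adelic set above $S$, i.e. a compact subset of $X_{\mathrm{aff}}^{\mathrm{an}}$ all of whose points lie above points of $S$. For $p\in S$ let $A_p$ be the set of points of $A$ above $p$; for $p\notin S$ let $A_p$ be the set of all points $v$ of $X_{\mathrm{aff}}^{\mathrm{an}}$ above $p$ with $v(x_i)\ge 0$ for all $i$. The Chebyshev constant $\mathrm{Ch}(A)\in[0,\infty]$ is defined by \[ -\log \mathrm{Ch}(A)=\lim_{m\to\infty}\frac1m\ \sup_{0\ne f\in L(mD)}\ \int_{p\in\Pi}\ \inf_{v\in A_p}v(f)\ d\mu_K(p), \] where $\inf\emptyset=+\infty$ (the negative part of the integrand is integrable, and the limit exists in $[0,\infty]$ by superadditivity). The adelic partial type $P_A$ is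 the set of (generic quantifier-free) types given by the GVF structures $\nu$ on $K(X)$ that extend $\mu_K$, such that $\nu$-almost every $v$ with $v|_K\in S$ satisfies $v|_{K[x]}\in A$, and such that, with $v^-=\max(0,-v)$ (and $v^-(0)=0$), \[ \int \max_i v^-(x_i)\,d\nu(v)=\int_{\{v\,:\,v|_K\in S\}}\max_i v^-(x_i)\,d\nu(v). \] Then $P_A$ is consistent, i.e. there is such a $\nu$, if and only if $\mathrm{Ch}(A)\ge 1$. -/

import Mathlib

open MeasureTheory Filter

noncomputable section

/-! ### Valuations and absolute values -/

/-- A real-valued (semi)valuation `v` of a commutative ring `R`, written multiplicatively as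
`|f| = exp (-v f)`: either a non-archimedean multiplicative seminorm, or a positive power of the
modulus of a ring homomorphism to `ℂ`. The elements `f` with `|f| = 0` are those with
`v f = +∞`. If `R` is a field there is no such `f` except `0`. -/
structure Place (R : Type*) [CommRing R] where
  toFun : R → ℝ
  nonneg : ∀ a, 0 ≤ toFun a
  zero : toFun 0 = 0
  one : toFun 1 = 1
  mul : ∀ a b, toFun (a * b) = toFun a * toFun b
  nonarch_or_arch : (∀ a b, toFun (a + b) ≤ max (toFun a) (toFun b)) ∨
    ∃ (σ : R →+* ℂ) (c : ℝ), 0 < c ∧ ∀ a, toFun a = ‖σ a‖ ^ c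

namespace Place

instance (R : Type*) [CommRing R] : CoeFun (Place R) (fun _ => R → ℝ) := ⟨Place.toFun⟩

/-- The topology of pointwise convergence. -/
instance (R : Type*) [CommRing R] : TopologicalSpace (Place R) :=
  TopologicalSpace.induced Place.toFun inferInstance

instance (R : Type*) [CommRing R] : MeasurableSpace (Place R) := borel _

instance (R : Type*) [CommRing R] : BorelSpace (Place R) := ⟨rfl⟩

/-- Pull-back of a valuation along a ring homomorphism. -/
def comap {R R' : Type*} [CommRing R] [CommRing R'] (φ : R →+* R') (v : Place R') : Place R where
  toFun a := v (φ a)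
  nonneg a := v.nonneg _
  zero := by rw [map_zero, v.zero]
  one := by rw [map_one, v.one]
  mul a b := by rw [map_mul, v.mul]
  nonarch_or_arch := by
    rcases v.nonarch_or_arch with h | ⟨σ, c, hc, h⟩
    · exact Or.inl fun a b => by rw [map_add]; exact h _ _
    · exact Or.inr ⟨σ.comp φ, c, hc, fun a => h _⟩

/-- Restriction of a valuation to the base field. -/
abbrev res (K : Type*) {R : Type*} [Field K] [CommRing R] [Algebra K R] (v : Place R) : Place K :=
  v.comap (algebraMap K R)

/-- The additive value `v f = -log |f|` in `(-∞, +∞]`. -/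
def ord {R : Type*} [CommRing R] (v : Place R) (f : R) : EReal :=
  -ENNReal.log (ENNReal.ofReal (v f))

/-- The additive value `v a = -log |a|` of a nonzero element of a field, as a real number. -/
def val {K : Type*} [Field K] (v : Place K) (a : K) : ℝ := -Real.log (v a)

def IsTrivial {K : Type*} [Field K] (v : Place K) : Prop := ∀ a : K, a ≠ 0 → v a = 1

/-- Equivalence: additively, one is a positive multiple of the other. -/
def Equivalent {K : Type*} [Field K] (v w : Place K) : Prop :=
  ∃ c : ℝ, 0 < c ∧ ∀ a : K, w a = v a ^ c

end Place

/-! ### Globally valued fields -/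

/-- A globally valued field structure: a measure, concentrated on a Borel set of representatives
of nontrivial valuations up to equivalence, satisfying the product formula. -/
structure GVF (K : Type*) [Field K] where
  reps : Set (Place K)
  measurableSet_reps : MeasurableSet reps
  nontrivial : ∀ v ∈ reps, ¬ v.IsTrivial
  inequivalent : ∀ v ∈ reps, ∀ w ∈ reps, v.Equivalent w → v = w
  measure : Measure (Place K)
  concentrated : measure repsᶜ = 0
  integrable : ∀ a : K, a ≠ 0 → Integrable (fun v => v.val a) measure
  product_formula : ∀ a : K, a ≠ 0 → ∫ v, v.val a ∂measure = 0

/-- `G'` on `F` induces `G` on `K`: restricting the valuations of `F` that are nontrivial on `K`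
to `K` pushes the measure of `G'` to that of `G`. -/
def GVF.Extends {K F : Type*} [Field K] [Field F] [Algebra K F] (G' : GVF F) (G : GVF K) : Prop :=
  (G'.measure.restrict {v | ¬ (v.res K).IsTrivial}).map (Place.res K) = G.measure

/-! ### Projective varieties with a hyperplane section -/

/-- An irreducible closed subvariety `X` of projective `n`-space over `K`, given by its
homogeneous prime ideal, not contained in the hyperplane `T₀ = 0`. It comes with the very ample
effective divisor `D` cut out on it by `T₀ = 0`. -/
structure ProjVariety (K : Type*) [Field K] (n : ℕ) where
  ideal : Ideal (MvPolynomial (Fin (n + 1)) K)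
  isPrime : ideal.IsPrime
  isHomogeneous : ∀ p ∈ ideal, ∀ d : ℕ, MvPolynomial.homogeneousComponent d p ∈ ideal
  X_zero_notMem : MvPolynomial.X 0 ∉ ideal

namespace ProjVariety

variable {K : Type*} [Field K] {n : ℕ}

/-- The homogeneous coordinate ring. -/
abbrev HomCoordRing (X : ProjVariety K n) : Type _ :=
  MvPolynomial (Fin (n + 1)) K ⧸ X.ideal

instance (X : ProjVariety K n) : IsDomain X.HomCoordRing :=
  (Ideal.Quotient.isDomain_iff_prime _).2 X.isPrime

/-- `Tᵢ / T₀` in the fraction field of the homogeneous coordinate ring. -/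
def ratio (X : ProjVariety K n) (i : Fin (n + 1)) : FractionRing X.HomCoordRing :=
  algebraMap X.HomCoordRing _ (Ideal.Quotient.mk X.ideal (MvPolynomial.X i)) /
    algebraMap X.HomCoordRing _ (Ideal.Quotient.mk X.ideal (MvPolynomial.X 0))

/-- The function field `K(X)`: the fractions of degree `0`, i.e. the subfield generated over `K`
by the `Tᵢ / T₀`. -/
def functionField (X : ProjVariety K n) : IntermediateField K (FractionRing X.HomCoordRing) :=
  IntermediateField.adjoin K (Set.range X.ratio)

/-- The coordinates `xᵢ = Tᵢ / T₀` as rational functions on `X`; in particular `x₀ = 1`. -/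
def coord (X : ProjVariety K n) (i : Fin (n + 1)) : X.functionField :=
  ⟨X.ratio i, IntermediateField.subset_adjoin K _ (Set.mem_range_self i)⟩

end ProjVariety

/-! ### Adelic sets, adelic types and the Chebyshev constant

In this section `F` is the function field of `X` and `x : Fin (n + 1) → F` the coordinates. -/

section Adelic

variable {K F : Type*} [Field K] [Field F] [Algebra K F] {n : ℕ}

/-- The coordinate ring `K[x]` of the affine variety `X ∖ D`. -/
abbrev affRing (K : Type*) {F : Type*} [Field K] [Field F] [Algebra K F] {n : ℕ}
    (x : Fin (n + 1) → F) : Subalgebra K F :=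
  Algebra.adjoin K (Set.range x)

/-- The generator `xᵢ` of `K[x]`. -/
def affCoord (K : Type*) {F : Type*} [Field K] [Field F] [Algebra K F] {n : ℕ}
    (x : Fin (n + 1) → F) (i : Fin (n + 1)) : affRing K x :=
  ⟨x i, Algebra.subset_adjoin (Set.mem_range_self i)⟩

/-- `L(mD)`: the rational functions `f` with `(f) + mD ≥ 0`. On the chart `Tᵢ ≠ 0` of `X` (which
is nonempty iff `xᵢ ≠ 0`) the ring of regular functions is `K[xⱼ / xᵢ]ⱼ` and `D` has the
equation `1 / xᵢ`. -/
def globalSections (K : Type*) {F : Type*} [Field K] [Field F] [Algebra K F] {n : ℕ}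
    (x : Fin (n + 1) → F) (m : ℕ) : Set F :=
  {f | ∀ i, x i ≠ 0 → f / x i ^ m ∈ Algebra.adjoin K (Set.range fun j => x j / x i)}

/-- `A` is a `D`-adelic set above `S`: `S` is a compact set of valuations of `K` contained in the
set of representatives, and `A` is a compact subset of the Berkovich space of `X ∖ D`, all
of whose points restrict to points of `S`. -/
structure IsAdelicSet (G : GVF K) (x : Fin (n + 1) → F) (S : Set (Place K))
    (A : Set (Place (affRing K x))) : Prop where
  isCompact_base : IsCompact S
  base_subset : S ⊆ G.reps
  isCompact : IsCompact A
  above : ∀ v ∈ A, v.res K ∈ S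

/-- The local height `maxᵢ v⁻(xᵢ) = maxᵢ log⁺ |xᵢ|`. -/
def localHeight (x : Fin (n + 1) → F) (v : Place F) : ℝ :=
  ⨆ i, Real.posLog (v (x i))

/-- The adelic type `P_A`: the types over `K` of generic points of `X`, that is, the globally
valued field structures on `F = K(X)` extending the one on `K`, such that the
measure above `S` concentrates on `A`, and the height of `x` is attained above `S`. -/
def adelicType (G : GVF K) (x : Fin (n + 1) → F) (S : Set (Place K))
    (A : Set (Place (affRing K x))) : Set (GVF F) :=
  {G' | G'.Extends G ∧
    (∀ᵐ v ∂G'.measure, v.res K ∈ S → v.comap (algebraMap (affRing K x) F) ∈ A) ∧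
    ∫ v, localHeight x v ∂G'.measure
      = ∫ v in {v | v.res K ∈ S}, localHeight x v ∂G'.measure}

open Classical in
/-- The set `A_p`: for `p ∈ S` the fibre of `A`, and for other `p` the set of points above `p`
of the Berkovich space of `X ∖ D` with integral coordinates. -/
def adelicFibre (x : Fin (n + 1) → F) (S : Set (Place K)) (A : Set (Place (affRing K x)))
    (p : Place K) : Set (Place (affRing K x)) :=
  if p ∈ S then {v | v ∈ A ∧ v.res K = p}
  else {v | v.res K = p ∧ ∀ i, v (affCoord K x i) ≤ 1}

/-- The integral of an extended-real function, as the integral of its positive part minus that of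
its negative part. -/
def eintegral {α : Type*} [MeasurableSpace α] (μ : Measure α) (g : α → EReal) : EReal :=
  ((∫⁻ a, (g a).toENNReal ∂μ : ENNReal) : EReal) - ((∫⁻ a, (-g a).toENNReal ∂μ : ENNReal) : EReal)

/-- `∫_p inf_{v ∈ A_p} v(f)`. The infimum over the empty set is `+∞`. -/
def infIntegral (G : GVF K) (x : Fin (n + 1) → F) (S : Set (Place K))
    (A : Set (Place (affRing K x))) (f : affRing K x) : EReal :=
  eintegral G.measure fun p => ⨅ v ∈ adelicFibre x S A p, v.ord f

/-- `a_m`, the supremum of `∫_p inf_{v ∈ A_p} v(f)` over the nonzero `f ∈ L(mD)`. As `x₀ = 1`, the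
chart `T₀ ≠ 0` in the definition of `L(mD)` shows that `L(mD)` is contained in `K[x]`. -/
def chebyshevTerm (G : GVF K) (x : Fin (n + 1) → F) (S : Set (Place K))
    (A : Set (Place (affRing K x))) (m : ℕ) : EReal :=
  ⨆ (f : affRing K x) (_ : (f : F) ∈ globalSections K x m) (_ : f ≠ 0), infIntegral G x S A f

/-- The Chebyshev constant `exp (-lim a_m / m)` in `[0, ∞]`. The sequence `a_m` is superadditive,
so the limit exists and is the upper limit. -/
def chebyshev (G : GVF K) (x : Fin (n + 1) → F) (S : Set (Place K))
    (A : Set (Place (affRing K x))) : ENNReal :=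
  EReal.exp (-(limsup (fun m : ℕ => chebyshevTerm G x S A m / (m : EReal)) atTop))

end Adelic

end

/-!
If `ν` is an adelic type, then almost every `v` above `p` restricts to a point of `A_p`, and almost
every `v` trivial on `K` is nonnegative on `K[x]`. So the product formula for `ν` bounds the
integral of `inf_{A_p} v(f)` by `0`, for every nonzero `f ∈ K[x]`.

Conversely, `Ch(A) ≥ 1` implies that `inf_{A_p} v(f)` is never bounded below by a function of `p`
with positive integral, since passing from `f` to `f ^ k` multiplies such a bound by `k`. By Riesz
extension there is a positive functional on functions on the union of the `A_p` which restricts to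
integration against `μ_K` and is nonpositive on the truncations `min(v(f), N)`, `f ≠ 0`. Up to a
null set the base is exhausted by compact sets above which the `A_p` form a compact set, so
Riesz-Markov turns the functional into a measure above `μ_K` with `∫ v(f) ≤ 0` for all nonzero
`f ∈ K[x]`. The defect `f ↦ -∫ v(f)` is a homomorphism on `K(X)ˣ` which is nonnegative on `K[x]`. A
second separation argument, on divisors of the normalization of `K[x]`, writes it as a
combination, with nonnegative real coefficients, of discrete valuations trivial on `K`. Adding
these as atoms restores the product formula.
-/

open Topology

theorem exists_ringHom_of_tendsto_norm {α R A : Type*} [NonAssocSemiring R] [NormedRing A]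
    [ProperSpace A] {u : Ultrafilter α} {σ : α → R →+* A} {N : R → ℝ}
    (hσ : ∀ a, Tendsto (fun y => ‖σ y a‖) u (𝓝 (N a))) : ∃ τ : R →+* A, ∀ a, ‖τ a‖ = N a := by
  have exists_lim : ∀ a, ∃ z : A, Tendsto (fun y => σ y a) u (𝓝 z) := fun a => by
    have bounded : ∀ᶠ y in (u : Filter α), σ y a ∈ Metric.closedBall (0 : A) (N a + 1) :=
      ((hσ a).eventually (eventually_le_nhds (lt_add_one _))).mono fun y hy => by
        simpa using hy
    obtain ⟨z, -, hz⟩ := (isCompact_closedBall (0 : A) (N a + 1)).ultrafilter_le_nhds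
      (u.map fun y => σ y a) (le_principal_iff.2 bounded)
    exact ⟨z, hz⟩
  choose z hz using exists_lim
  let τ : R →+* A :=
    { toFun := z
      map_one' := tendsto_nhds_unique (hz 1) (by simp)
      map_mul' := fun a b => tendsto_nhds_unique (hz _) (by simpa using (hz a).mul (hz b))
      map_zero' := tendsto_nhds_unique (hz 0) (by simp)
      map_add' := fun a b => tendsto_nhds_unique (hz _) (by simpa using (hz a).add (hz b)) }
  exact ⟨τ, fun a => tendsto_nhds_unique (hz a).norm (hσ a)⟩

namespace Place

section Topology

variable {R : Type*} [CommRing R]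

theorem toFun_injective : Function.Injective (Place.toFun : Place R → R → ℝ) := by
  rintro ⟨⟩ ⟨⟩ h
  cases h
  rfl

theorem isEmbedding_toFun : IsEmbedding (Place.toFun : Place R → R → ℝ) :=
  ⟨⟨rfl⟩, toFun_injective⟩

theorem continuous_eval (f : R) : Continuous fun v : Place R => v f :=
  (continuous_apply f).comp isEmbedding_toFun.continuous

theorem measurable_eval (f : R) : Measurable fun v : Place R => v f :=
  (continuous_eval f).measurable

instance : T2Space (Place R) := isEmbedding_toFun.t2Space

theorem continuous_comap {R' : Type*} [CommRing R'] (φ : R →+* R') :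
    Continuous (Place.comap φ) :=
  isEmbedding_toFun.continuous_iff.2 <| continuous_pi fun a => continuous_eval (φ a)

theorem map_pow (v : Place R) (f : R) (k : ℕ) : v (f ^ k) = v f ^ k := by
  induction k with
  | zero => simp [v.one]
  | succ k ih => rw [pow_succ, v.mul, ih, pow_succ]

theorem add_le_max_one_two_mul_max (v : Place R) (a b : R) :
    v (a + b) ≤ max 1 (v 2) * max (v a) (v b) := by
  have max_nonneg : 0 ≤ max (v a) (v b) := le_max_of_le_left (v.nonneg a)
  rcases v.nonarch_or_arch with nonarch | ⟨σ, c, hc, hσ⟩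
  · exact (nonarch a b).trans (le_mul_of_one_le_left max_nonneg (le_max_left _ _))
  · have add_le : ‖σ (a + b)‖ ≤ 2 * max ‖σ a‖ ‖σ b‖ := by
      rw [map_add]
      linarith [norm_add_le (σ a) (σ b), le_max_left ‖σ a‖ ‖σ b‖, le_max_right ‖σ a‖ ‖σ b‖]
    have max_eq : max (v a) (v b) = max ‖σ a‖ ‖σ b‖ ^ c := by
      rw [hσ, hσ]
      exact ((Real.monotoneOn_rpow_Ici_of_exponent_nonneg hc.le).map_max
        (norm_nonneg _) (norm_nonneg _)).symm
    calc v (a + b) ≤ (2 * max ‖σ a‖ ‖σ b‖) ^ c := by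
          rw [hσ]; exact Real.rpow_le_rpow (norm_nonneg _) add_le hc.le
      _ = v 2 * max (v a) (v b) := by
          rw [Real.mul_rpow zero_le_two (le_max_of_le_left (norm_nonneg _)), max_eq, hσ 2,
            map_ofNat, RCLike.norm_ofNat]
      _ ≤ max 1 (v 2) * max (v a) (v b) := by gcongr; exact le_max_right _ _

end Topology

section UltrafilterLimit

variable {R : Type*} [CommRing R] {u : Ultrafilter (Place R)} {N : R → ℝ}

/- The exponents converge to `log₂ (N 2)`. If this is `0`, the weak triangle inequality passes to
the limit with constant `1`; otherwise the absolute values `‖σ ·‖` themselves converge. -/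
theorem nonarch_or_arch_of_tendsto_arch (hN : Tendsto Place.toFun u (𝓝 N))
    (harch : ∀ᶠ v : Place R in u, ∃ (σ : R →+* ℂ) (c : ℝ), 0 < c ∧ ∀ a, v a = ‖σ a‖ ^ c) :
    (∀ a b, N (a + b) ≤ max (N a) (N b)) ∨
      ∃ (σ : R →+* ℂ) (c : ℝ), 0 < c ∧ ∀ a, N a = ‖σ a‖ ^ c := by
  have hN' : ∀ a, Tendsto (fun v : Place R => v a) u (𝓝 (N a)) := tendsto_pi_nhds.1 hN
  obtain ⟨_, σ₀, -⟩ := harch.exists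
  have : Nonempty (R →+* ℂ) := ⟨σ₀⟩
  choose! σ c hσ using fun (v : Place R) (h : ∃ (σ : R →+* ℂ) (c : ℝ), 0 < c ∧
    ∀ a, v a = ‖σ a‖ ^ c) => h
  replace harch : ∀ᶠ v : Place R in u, 0 < c v ∧ ∀ a, v a = ‖σ v a‖ ^ c v :=
    harch.mono hσ
  have two_eq : ∀ᶠ v : Place R in u, v 2 = 2 ^ c v := harch.mono fun v hv => by
    rw [hv.2, map_ofNat, RCLike.norm_ofNat]
  have one_le_two : 1 ≤ N 2 := ge_of_tendsto (hN' 2) <| (harch.and two_eq).mono fun v hv => by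
    rw [hv.2]; exact Real.one_le_rpow (by norm_num) hv.1.1.le
  rcases one_le_two.eq_or_lt with two_eq_one | one_lt_two
  · refine Or.inl fun a b => ?_
    simpa [← two_eq_one] using le_of_tendsto_of_tendsto' (hN' (a + b))
      ((tendsto_const_nhds.max (hN' 2)).mul ((hN' a).max (hN' b)))
      fun v => v.add_le_max_one_two_mul_max a b
  have tendsto_exponent : Tendsto c u (𝓝 (Real.logb 2 (N 2))) := by
    refine ((hN' 2).logb (zero_lt_one.trans one_lt_two).ne').congr' (two_eq.mono fun v hv => ?_)
    rw [hv, Real.logb_rpow (by norm_num) (by norm_num)]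
  have exponent_pos : 0 < Real.logb 2 (N 2) := Real.logb_pos (by norm_num) one_lt_two
  obtain ⟨τ, hτ⟩ := exists_ringHom_of_tendsto_norm (u := u) (σ := σ) fun a =>
    ((hN' a).rpow (tendsto_exponent.inv₀ exponent_pos.ne') (Or.inr (inv_pos.2 exponent_pos))).congr'
      (harch.mono fun v hv => by rw [hv.2, Real.rpow_rpow_inv (norm_nonneg _) hv.1.ne'])
  have nonneg (a : R) : 0 ≤ N a := ge_of_tendsto' (hN' a) fun v => v.nonneg a
  exact Or.inr ⟨τ, _, exponent_pos, fun a => by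
    rw [hτ, Real.rpow_inv_rpow (nonneg a) exponent_pos.ne']⟩

theorem mem_range_toFun_of_tendsto (hN : Tendsto Place.toFun u (𝓝 N)) :
    N ∈ Set.range (Place.toFun : Place R → R → ℝ) := by
  have hN' : ∀ a, Tendsto (fun v : Place R => v a) u (𝓝 (N a)) := tendsto_pi_nhds.1 hN
  have nonarch_or_arch : (∀ a b, N (a + b) ≤ max (N a) (N b)) ∨
      ∃ (σ : R →+* ℂ) (c : ℝ), 0 < c ∧ ∀ a, N a = ‖σ a‖ ^ c := by
    rcases Ultrafilter.eventually_or.1 (Eventually.of_forall (f := (u : Filter (Place R)))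
      Place.nonarch_or_arch) with nonarch | arch
    · exact Or.inl fun a b => le_of_tendsto_of_tendsto (hN' _) ((hN' a).max (hN' b))
        (nonarch.mono fun v hv => hv a b)
    · exact nonarch_or_arch_of_tendsto_arch hN arch
  exact ⟨{
    toFun := N
    nonneg := fun a => ge_of_tendsto' (hN' a) fun v => v.nonneg a
    zero := tendsto_nhds_unique (hN' 0) (by simp [Place.zero])
    one := tendsto_nhds_unique (hN' 1) (by simp [Place.one])
    mul := fun a b => tendsto_nhds_unique (hN' _) (by simpa [Place.mul] using (hN' a).mul (hN' b))
    nonarch_or_arch := nonarch_or_arch }, rfl⟩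

end UltrafilterLimit

section Compactness

variable {R : Type*} [CommRing R]

theorem isClosedEmbedding_toFun : IsClosedEmbedding (Place.toFun : Place R → R → ℝ) := by
  refine ⟨isEmbedding_toFun, isClosed_iff_ultrafilter.2 fun N u hu hmem => ?_⟩
  exact mem_range_toFun_of_tendsto (u := u.comap toFun_injective hmem) (tendsto_comap.mono_right hu)

instance [Countable R] : PolishSpace (Place R) := isClosedEmbedding_toFun.polishSpace

theorem isCompact_of_isClosed_of_bounded {s : Set (Place R)} (hs : IsClosed s)
    (hb : ∀ f, ∃ C : ℝ, ∀ v ∈ s, v f ≤ C) : IsCompact s := by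
  choose C hC using hb
  have isCompact_box : IsCompact (Place.toFun ⁻¹' Set.univ.pi fun f : R => Set.Icc 0 (C f)) :=
    isClosedEmbedding_toFun.isCompact_preimage (isCompact_univ_pi fun _ => isCompact_Icc)
  exact isCompact_box.of_isClosed_subset hs fun v hv f _ => ⟨v.nonneg f, hC f v hv⟩

end Compactness

end Place

section Separation

variable {E : Type*} [AddCommGroup E] [Module ℝ E]

/-- The vectors of `E × ℝ` all of whose multiples lie in `Γ`, up to a bounded error in the last
coordinate: the convex cone of homogeneous inequalities `0 ≤ Λ e + t` implied by the additive
family `Γ` of inequalities. -/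
def homogenizedCone (Γ : AddSubmonoid (E × ℝ)) (hup : ∀ e t t', t ≤ t' → (e, t) ∈ Γ → (e, t') ∈ Γ)
    (hsegment : ∀ e : E, ∃ u : ℝ, ∀ r : ℝ, 0 ≤ r → r ≤ 1 → (r • e, u) ∈ Γ) :
    PointedCone ℝ (E × ℝ) where
  carrier := {x | ∃ B : ℝ, ∀ k : ℕ, ((k : ℝ) • x.1, k * x.2 + B) ∈ Γ}
  add_mem' := by
    rintro ⟨e, t⟩ ⟨e', t'⟩ ⟨B, hB⟩ ⟨B', hB'⟩
    refine ⟨B + B', fun k => ?_⟩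
    convert Γ.add_mem (hB k) (hB' k) using 1
    simp only [Prod.mk_add_mk, smul_add, Prod.mk.injEq, true_and]
    ring
  zero_mem' := ⟨0, fun k => by simp [← Prod.zero_eq_mk, Γ.zero_mem]⟩
  smul_mem' := by
    rintro ⟨r, hr⟩ ⟨e, t⟩ ⟨B, hB⟩
    obtain ⟨u, hu⟩ := hsegment (-e)
    refine ⟨B + u + |t|, fun k => ?_⟩
    -- Round `k * r` up to an integer; the excess lies in `[0, 1]` and is paid for by `hu`.
    have le_ceil : (k : ℝ) * r ≤ ⌈(k : ℝ) * r⌉₊ := Nat.le_ceil _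
    have ceil_lt : (⌈(k : ℝ) * r⌉₊ : ℝ) < k * r + 1 :=
      Nat.ceil_lt_add_one (mul_nonneg k.cast_nonneg hr)
    have rounded := Γ.add_mem (hB ⌈(k : ℝ) * r⌉₊)
      (hu (⌈(k : ℝ) * r⌉₊ - k * r) (by linarith) (by linarith))
    rw [Prod.mk_add_mk, smul_neg, ← sub_eq_add_neg, ← sub_smul, sub_sub_cancel] at rounded
    change ((k : ℝ) • (r • e), (k : ℝ) * (r * t) + (B + u + |t|)) ∈ Γ
    rw [smul_smul]
    refine hup _ _ _ ?_ rounded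
    nlinarith [le_abs_self t, neg_abs_le t, abs_nonneg t]

variable {Γ : AddSubmonoid (E × ℝ)} {hup : ∀ e t t', t ≤ t' → (e, t) ∈ Γ → (e, t') ∈ Γ}
  {hsegment : ∀ e : E, ∃ u : ℝ, ∀ r : ℝ, 0 ≤ r → r ≤ 1 → (r • e, u) ∈ Γ}

theorem mem_homogenizedCone_of_mem {x : E × ℝ} (hx : x ∈ Γ) : x ∈ homogenizedCone Γ hup hsegment :=
  ⟨0, fun k => by
    rw [add_zero]
    simpa only [← Nat.cast_smul_eq_nsmul ℝ, Prod.smul_def, smul_eq_mul] using Γ.nsmul_mem hx k⟩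

theorem nonneg_of_zero_mem_homogenizedCone (hzero : ∀ t, ((0 : E), t) ∈ Γ → 0 ≤ t) {t : ℝ}
    (ht : ((0 : E), t) ∈ homogenizedCone Γ hup hsegment) : 0 ≤ t := by
  obtain ⟨B, hB⟩ := ht
  by_contra! ht
  obtain ⟨k, hk⟩ := exists_nat_gt (B / -t)
  rw [div_lt_iff₀ (by linarith)] at hk
  have := hzero _ (by simpa using hB k)
  linarith

theorem exists_linearMap_of_constraints (hup : ∀ e t t', t ≤ t' → (e, t) ∈ Γ → (e, t') ∈ Γ)
    (hzero : ∀ t, ((0 : E), t) ∈ Γ → 0 ≤ t)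
    (hsegment : ∀ e : E, ∃ u : ℝ, ∀ r : ℝ, 0 ≤ r → r ≤ 1 → (r • e, u) ∈ Γ) :
    ∃ Λ : E →ₗ[ℝ] ℝ, ∀ e t, (e, t) ∈ Γ → 0 ≤ Λ e + t := by
  let heightOnAxis : E × ℝ →ₗ.[ℝ] ℝ :=
    { domain := LinearMap.ker (LinearMap.fst ℝ E ℝ)
      toFun := (LinearMap.snd ℝ E ℝ).comp (Submodule.subtype _) }
  obtain ⟨g, g_extends, g_nonneg⟩ := riesz_extension (homogenizedCone Γ hup hsegment) heightOnAxis
    (by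
      rintro ⟨⟨e, t⟩, rfl : e = 0⟩ ht
      exact nonneg_of_zero_mem_homogenizedCone hzero ht)
    (by
      rintro ⟨e, t⟩
      obtain ⟨u, hu⟩ := hsegment e
      refine ⟨⟨(0, u - t), by simp [heightOnAxis]⟩, mem_homogenizedCone_of_mem ?_⟩
      simpa using hu 1 zero_le_one le_rfl)
  refine ⟨g.comp (LinearMap.inl ℝ E ℝ), fun e t h => ?_⟩
  have g_axis : g (0, t) = t := g_extends ⟨(0, t), by simp [heightOnAxis]⟩
  calc 0 ≤ g (e, t) := g_nonneg _ (mem_homogenizedCone_of_mem h)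
    _ = g (e, 0) + g (0, t) := by rw [← map_add, Prod.mk_add_mk, add_zero, zero_add]
    _ = g.comp (LinearMap.inl ℝ E ℝ) e + t := by rw [g_axis]; rfl

end Separation

namespace Place

variable {F : Type*} [Field F]

section Values

variable (v : Place F) {f g : F}

theorem map_inv (f : F) : v f⁻¹ = (v f)⁻¹ := by
  rcases eq_or_ne f 0 with rfl | hf
  · simp [v.zero]
  · exact eq_inv_of_mul_eq_one_left (by rw [← v.mul, inv_mul_cancel₀ hf, v.one])

theorem pos_of_ne_zero (hf : f ≠ 0) : 0 < v f := by
  refine (v.nonneg f).lt_of_ne fun h => one_ne_zero (α := ℝ) ?_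
  rw [← v.one, ← mul_inv_cancel₀ hf, v.mul, ← h, zero_mul]

theorem ne_zero_of_apply_ne_zero {v : Place F} (h : v f ≠ 0) : f ≠ 0 := by
  rintro rfl
  exact h v.zero

theorem eq_one_of_le_one_of_inv_le_one (hf : f ≠ 0) (h : v f ≤ 1) (h' : v f⁻¹ ≤ 1) :
    v f = 1 := by
  rw [map_inv, inv_le_one₀ (v.pos_of_ne_zero hf)] at h'
  exact h.antisymm h'

theorem val_nonneg_iff : 0 ≤ v.val f ↔ v f ≤ 1 := by
  rw [val, neg_nonneg, Real.log_nonpos_iff (v.nonneg f)]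

theorem val_ne_zero_iff (hf : f ≠ 0) : v.val f ≠ 0 ↔ v f ≠ 1 := by
  have := v.pos_of_ne_zero hf
  rw [val, neg_ne_zero, Real.log_ne_zero]
  exact ⟨fun h => h.2.1, fun h => ⟨this.ne', h, by linarith⟩⟩

theorem exists_one_lt_of_not_isTrivial {v : Place F} (hv : ¬ v.IsTrivial) : ∃ f ≠ 0, 1 < v f := by
  simp only [IsTrivial, not_forall] at hv
  obtain ⟨f, hf, hvf⟩ := hv
  rcases Ne.lt_or_gt hvf with h | h
  · exact ⟨f⁻¹, inv_ne_zero hf, by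
      rw [map_inv]; exact (one_lt_inv₀ (v.pos_of_ne_zero hf)).2 h⟩
  · exact ⟨f, hf, h⟩

end Values

/-- A family of nontrivial places in which equivalent members are equal: its members can serve as
representatives of their classes in a globally valued field. -/
structure IsRepresentativeFamily {ι : Type*} (w : ι → Place F) : Prop where
  nontrivial : ∀ i, ¬ (w i).IsTrivial
  eq_of_equivalent : ∀ i j, (w i).Equivalent (w j) → w i = w j

/-- A place with value group `exp ℤ`, the normalization that makes equivalent discrete places
equal. -/
def IsNormalized (v : Place F) : Prop :=
  (∀ f : F, f ≠ 0 → ∃ k : ℤ, v f = Real.exp k) ∧ ∃ f : F, v f = Real.exp 1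

namespace IsNormalized

variable {v w : Place F}

theorem not_isTrivial (hv : v.IsNormalized) : ¬ v.IsTrivial := fun htriv => by
  obtain ⟨f, hf⟩ := hv.2
  rw [htriv f (ne_zero_of_apply_ne_zero (hf ▸ (Real.exp_pos 1).ne')), eq_comm,
    Real.exp_eq_one_iff] at hf
  exact one_ne_zero hf

theorem exists_int_of_forall_eq_rpow (hv : v.IsNormalized) (hw : w.IsNormalized) {c : ℝ}
    (h : ∀ a, w a = v a ^ c) : ∃ k : ℤ, c = k := by
  obtain ⟨f, hf⟩ := hv.2
  obtain ⟨k, hk⟩ := hw.1 f (ne_zero_of_apply_ne_zero (hf ▸ (Real.exp_pos 1).ne'))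
  refine ⟨k, Real.exp_injective ?_⟩
  rw [← hk, h, hf, Real.exp_one_rpow]

theorem eq_of_equivalent (hv : v.IsNormalized) (hw : w.IsNormalized) (h : v.Equivalent w) :
    v = w := by
  obtain ⟨c, hc, h⟩ := h
  have h_symm : ∀ a, v a = w a ^ c⁻¹ := fun a => by
    rw [h, Real.rpow_rpow_inv (v.nonneg a) hc.ne']
  obtain ⟨k, hk⟩ := hv.exists_int_of_forall_eq_rpow hw h
  obtain ⟨m, hm⟩ := hw.exists_int_of_forall_eq_rpow hv h_symm
  have k_pos : 0 < k := by rw [hk] at hc; exact_mod_cast hc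
  have k_mul_m : k * m = 1 := by
    have := mul_inv_cancel₀ hc.ne'
    rw [hm, hk] at this
    exact_mod_cast this
  have c_eq_one : c = 1 := by
    rw [hk, (Int.eq_one_or_neg_one_of_mul_eq_one k_mul_m).resolve_right (by omega), Int.cast_one]
  exact toFun_injective (funext fun a => by rw [h a, c_eq_one, Real.rpow_one])

end IsNormalized

theorem isRepresentativeFamily_of_isNormalized {ι : Type*} {w : ι → Place F}
    (hw : ∀ i, (w i).IsNormalized) : IsRepresentativeFamily w :=
  ⟨fun i => (hw i).not_isTrivial, fun i j => (hw i).eq_of_equivalent (hw j)⟩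

section OfValuation

open WithZero

theorem one_lt_toNNReal_exp_one : 1 < Real.toNNReal (Real.exp 1) :=
  Real.one_lt_toNNReal.2 (Real.one_lt_exp_iff.2 one_pos)

/-- The place attached to a discrete valuation, with `exp k` sent to the real number `exp k`. -/
noncomputable def ofValuation (v : Valuation F ℤᵐ⁰) : Place F where
  toFun f := WithZeroMulInt.toNNReal one_lt_toNNReal_exp_one.ne_zero (v f)
  nonneg _ := NNReal.coe_nonneg _
  zero := by simp
  one := by simp
  mul a b := by simp
  nonarch_or_arch := by
    refine Or.inl fun a b => ?_
    have hmono := (WithZeroMulInt.toNNReal_strictMono one_lt_toNNReal_exp_one).monotone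
    rw [← NNReal.coe_max, ← hmono.map_max]
    exact_mod_cast hmono (v.map_add a b)

theorem ofValuation_le_one (v : Valuation F ℤᵐ⁰) (f : F) : ofValuation v f ≤ 1 ↔ v f ≤ 1 := by
  rw [← (WithZeroMulInt.toNNReal_strictMono one_lt_toNNReal_exp_one).le_iff_le, map_one,
    ← NNReal.coe_le_coe]
  rfl

theorem ofValuation_eq_exp {v : Valuation F ℤᵐ⁰} {f : F} {k : ℤ} (hk : v f = exp k) :
    ofValuation v f = Real.exp k := by
  have hvf : v f ≠ 0 := hk ▸ exp_ne_zero
  have hunzero : WithZero.unzero hvf = Multiplicative.ofAdd k :=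
    WithZero.coe_injective (by rw [WithZero.coe_unzero, hk]; rfl)
  change ((WithZeroMulInt.toNNReal _ (v f) : NNReal) : ℝ) = _
  rw [WithZeroMulInt.toNNReal_neg_apply _ hvf, hunzero, NNReal.coe_zpow, toAdd_ofAdd,
    ← Real.rpow_intCast, Real.coe_toNNReal _ (Real.exp_pos 1).le, Real.exp_one_rpow]

theorem ofValuation_isNormalized {v : Valuation F ℤᵐ⁰} (hv : Function.Surjective v) :
    (ofValuation v).IsNormalized := by
  refine ⟨fun f hf =>
    ⟨log (v f), ofValuation_eq_exp (exp_log ((Valuation.ne_zero_iff v).2 hf)).symm⟩, ?_⟩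
  obtain ⟨f, hf⟩ := hv (exp 1)
  exact ⟨f, by simpa using ofValuation_eq_exp hf⟩

end OfValuation

end Place

/-- The places `w i` of `L` exhibit the integral closure of `B` in `L` as a Krull ring: it is their
common unit ball, and each nonzero element of `L` has absolute value `1` at almost all of them. -/
structure IsKrullFamily (B : Type*) {L ι : Type*} [CommRing B] [Field L] [Algebra B L]
    (w : ι → Place L) : Prop where
  isIntegral_iff : ∀ f, IsIntegral B f ↔ ∀ i, w i f ≤ 1
  finite_ne_one : ∀ f ≠ 0, {i | w i f ≠ 1}.Finite

open IsDedekindDomain in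
theorem exists_isKrullFamily_of_isDedekindDomain {D E L : Type*} [CommRing D] [Field E] [Field L]
    [Algebra D E] [IsFractionRing D E] [Algebra E L] [Algebra D L] [IsScalarTower D E L]
    [FiniteDimensional E L] [Algebra.IsSeparable E L] [IsDedekindDomain D] :
    ∃ w : HeightOneSpectrum (integralClosure D L) → Place L,
      IsKrullFamily D w ∧ ∀ i, (w i).IsNormalized := by
  have := integralClosure.isDedekindDomain D E L
  have : IsFractionRing (integralClosure D L) L :=
    integralClosure.isFractionRing_of_finite_extension E L
  refine ⟨fun i => Place.ofValuation (i.valuation L), ⟨fun f => ⟨fun hf i => ?_, fun hf => ?_⟩,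
    fun f hf => ?_⟩, fun i => Place.ofValuation_isNormalized (i.valuation_surjective L)⟩
  · exact (Place.ofValuation_le_one _ _).2 (i.valuation_le_one (⟨f, hf⟩ : integralClosure D L))
  · obtain ⟨g, rfl⟩ := HeightOneSpectrum.mem_integers_of_valuation_le_one
      (R := integralClosure D L) L f fun i => (Place.ofValuation_le_one _ _).1 (hf i)
    exact g.2
  · refine ((HeightOneSpectrum.Support.finite (integralClosure D L) f).union
      (HeightOneSpectrum.Support.finite (integralClosure D L) f⁻¹)).subset fun i hi => ?_
    by_contra h
    simp only [HeightOneSpectrum.Support, Set.mem_union, Set.mem_ofPred_eq, not_or, not_lt,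
      ← Place.ofValuation_le_one] at h
    exact hi (Place.eq_one_of_le_one_of_inv_le_one _ hf h.1 h.2)

section PrimeLocalization

variable {B E : Type*} [CommRing B] [IsDomain B] [Field E] [Algebra B E] [IsFractionRing B E]

/-- The local ring of `B` at a prime ideal, realized inside the fraction field. -/
noncomputable abbrev primeLocalization (E : Type*) [Field E] [Algebra B E] [IsFractionRing B E]
    (𝔭 : Ideal B) [𝔭.IsPrime] : Subalgebra B E :=
  Localization.subalgebra.ofField E 𝔭.primeCompl 𝔭.primeCompl_le_nonZeroDivisors

theorem mem_primeLocalization {𝔭 : Ideal B} [𝔭.IsPrime] {e : E} :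
    e ∈ primeLocalization E 𝔭 ↔
      ∃ a s : B, s ∉ 𝔭 ∧ e = algebraMap B E a * (algebraMap B E s)⁻¹ := by
  change (∃ (a s : B) (_ : s ∈ 𝔭.primeCompl), _) ↔ _
  simp [Ideal.primeCompl]

theorem isDedekindDomain_primeLocalization [IsNoetherianRing B] {𝔭 : Ideal B} [𝔭.IsPrime]
    [h𝔭 : 𝔭.IsPrincipal] : IsDedekindDomain (primeLocalization E 𝔭) := by
  have : IsLocalization.AtPrime (primeLocalization E 𝔭) 𝔭 :=
    Localization.subalgebra.isLocalization_ofField E _ _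
  have := IsLocalization.AtPrime.isLocalRing (primeLocalization E 𝔭) 𝔭
  have := IsLocalization.isNoetherianRing 𝔭.primeCompl (primeLocalization E 𝔭) inferInstance
  refine ((tfae_of_isNoetherianRing_of_isLocalRing_of_isDomain
    (primeLocalization E 𝔭)).out 4 2).1 ?_
  rw [← IsLocalization.AtPrime.map_eq_maximalIdeal 𝔭]
  exact h𝔭.map_ringHom _

theorem isIntegral_primeLocalization_of_smul {L : Type*} [Field L] [Algebra E L] [Algebra B L]
    [IsScalarTower B E L] {𝔭 : Ideal B} [𝔭.IsPrime] {b : B} (hb : b ∉ 𝔭) {z : L}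
    (hz : IsIntegral B (b • z)) : IsIntegral (primeLocalization E 𝔭) z := by
  have b_ne_zero : algebraMap B E b ≠ 0 :=
    (map_ne_zero_iff _ (IsFractionRing.injective B E)).2 fun h => hb (h ▸ 𝔭.zero_mem)
  let b_inv : primeLocalization E 𝔭 :=
    ⟨(algebraMap B E b)⁻¹, mem_primeLocalization.2 ⟨1, b, hb, by simp⟩⟩
  have z_eq : z = algebraMap (primeLocalization E 𝔭) L b_inv * (b • z) := by
    rw [Algebra.smul_def, ← mul_assoc, IsScalarTower.algebraMap_apply B E L]
    change z = algebraMap E L (algebraMap B E b)⁻¹ * _ * z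
    rw [← _root_.map_mul, inv_mul_cancel₀ b_ne_zero, _root_.map_one, one_mul]
  rw [z_eq]
  exact isIntegral_algebraMap.mul hz.tower_top

variable [UniqueFactorizationMonoid B]

theorem finite_setOf_isPrime_isPrincipal_mem {b : B} (hb : b ≠ 0) :
    {𝔭 : Ideal B | 𝔭.IsPrime ∧ 𝔭.IsPrincipal ∧ b ∈ 𝔭}.Finite := by
  classical
  obtain ⟨s, hs, hsb⟩ := UniqueFactorizationMonoid.exists_prime_factors b hb
  refine ((s.toFinset.finite_toSet).image fun q => Ideal.span {q}).subset ?_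
  rintro 𝔭 ⟨isPrime, ⟨π, rfl⟩, hmem⟩
  have π_dvd : π ∣ b := Ideal.mem_span_singleton.1 hmem
  have π_prime : Prime π := (Ideal.span_singleton_prime (ne_zero_of_dvd_ne_zero hb π_dvd)).1 isPrime
  obtain ⟨q, hq, hdvd⟩ := π_prime.exists_mem_multiset_dvd (hsb.dvd_iff_dvd_right.2 π_dvd)
  exact ⟨q, by simpa using hq, Ideal.span_singleton_eq_span_singleton.2
    (π_prime.associated_of_dvd (hs q hq) hdvd).symm⟩

theorem not_dvd_den_of_mem_primeLocalization {π : B} (hπ : Prime π) [(Ideal.span {π}).IsPrime]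
    {e : E} (he : e ∈ primeLocalization E (Ideal.span {π})) :
    ¬ π ∣ (IsFractionRing.den B e : B) := by
  intro π_dvd_den
  obtain ⟨a, s, hs, he⟩ := mem_primeLocalization.1 he
  rw [Ideal.mem_span_singleton] at hs
  have s_ne_zero : algebraMap B E s ≠ 0 :=
    (map_ne_zero_iff _ (IsFractionRing.injective B E)).2 fun h => hs (h ▸ dvd_zero π)
  have num_mul_s : IsFractionRing.num B e * s = a * IsFractionRing.den B e := by
    apply IsFractionRing.injective B E
    have e_mul_s : e * algebraMap B E s = algebraMap B E a := by
      rw [he, inv_mul_cancel_right₀ s_ne_zero]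
    have e_mul_den := (IsFractionRing.num_mul_den_eq_num_iff_eq (A := B)).2 (Eq.refl e)
    rw [map_mul, map_mul, ← e_mul_s, ← e_mul_den]
    ring
  have π_dvd_num : π ∣ IsFractionRing.num B e :=
    (hπ.dvd_or_dvd (num_mul_s ▸ π_dvd_den.mul_left a)).resolve_right hs
  exact hπ.not_isUnit (IsFractionRing.num_den_reduced B e π_dvd_num π_dvd_den)

theorem mem_range_of_forall_mem_primeLocalization {e : E}
    (h : ∀ (𝔭 : Ideal B) [𝔭.IsPrime] [𝔭.IsPrincipal], e ∈ primeLocalization E 𝔭) :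
    e ∈ (algebraMap B E).range := by
  suffices IsUnit (IsFractionRing.den B e : B) from IsFractionRing.isInteger_of_isUnit_den this
  by_contra not_isUnit
  obtain ⟨π, π_irreducible, π_dvd⟩ := WfDvdMonoid.exists_irreducible_factor not_isUnit
    (nonZeroDivisors.ne_zero (IsFractionRing.den B e).2)
  have : (Ideal.span {π}).IsPrime :=
    (Ideal.span_singleton_prime π_irreducible.ne_zero).2 π_irreducible.prime
  have : (Ideal.span {π}).IsPrincipal := ⟨π, rfl⟩
  exact not_dvd_den_of_mem_primeLocalization π_irreducible.prime (h _) π_dvd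

theorem isIntegral_of_forall_isIntegral_primeLocalization [IsNoetherianRing B] {L : Type*}
    [Field L] [Algebra E L] [Algebra B L] [IsScalarTower B E L] {f : L}
    (h : ∀ (𝔭 : Ideal B) [𝔭.IsPrime] [𝔭.IsPrincipal], IsIntegral (primeLocalization E 𝔭) f)
    (hE : IsIntegral E f) : IsIntegral B f := by
  have coeff_mem : ∀ i, (minpoly E f).coeff i ∈ (algebraMap B E).range := fun i => by
    refine mem_range_of_forall_mem_primeLocalization fun 𝔭 _ _ => ?_
    have := isDedekindDomain_primeLocalization (E := E) (𝔭 := 𝔭)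
    have hmin := minpoly.isIntegrallyClosed_eq_field_fractions E L (h 𝔭)
    rw [Algebra.algebraMap_self, RingHom.id_apply] at hmin
    rw [hmin, Polynomial.coeff_map]
    exact Subtype.property _
  obtain ⟨r, hr, -, r_monic⟩ := Polynomial.lifts_and_natDegree_eq_and_monic
    ((Polynomial.lifts_iff_coeff_lifts (minpoly E f)).2 coeff_mem) (minpoly.monic hE)
  refine ⟨r, r_monic, ?_⟩
  rw [IsScalarTower.algebraMap_eq B E L, ← Polynomial.eval₂_map, hr]
  exact minpoly.aeval E f

end PrimeLocalization

universe uB uE uL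

theorem exists_isKrullFamily_of_isSeparable {B : Type uB} {E : Type uE} {L : Type uL}
    [CommRing B] [IsDomain B] [UniqueFactorizationMonoid B] [IsNoetherianRing B] [Field E]
    [Algebra B E] [IsFractionRing B E] [Field L] [Algebra E L] [Algebra B L] [IsScalarTower B E L]
    [FiniteDimensional E L] [Algebra.IsSeparable E L] :
    ∃ (ι : Type max uB uL) (w : ι → Place L), IsKrullFamily B w ∧ ∀ i, (w i).IsNormalized := by
  let T := {𝔭 : Ideal B // 𝔭.IsPrime ∧ 𝔭.IsPrincipal}
  have (𝔭 : T) : 𝔭.1.IsPrime := 𝔭.2.1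
  have (𝔭 : T) : 𝔭.1.IsPrincipal := 𝔭.2.2
  have exists_local (𝔭 : T) : ∃ (ι : Type uL) (w : ι → Place L),
      IsKrullFamily (primeLocalization E 𝔭.1) w ∧ ∀ i, (w i).IsNormalized := by
    have := isDedekindDomain_primeLocalization (E := E) (𝔭 := 𝔭.1)
    exact ⟨_, exists_isKrullFamily_of_isDedekindDomain (E := E)⟩
  choose ι w krull normalized using exists_local
  refine ⟨Σ 𝔭, ι 𝔭, fun i => w i.1 i.2, ⟨fun f => ⟨fun hf i => ?_, fun hf => ?_⟩, fun f hf => ?_⟩,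
    fun i => normalized _ _⟩
  · exact ((krull i.1).isIntegral_iff f).1 hf.tower_top i.2
  · exact isIntegral_of_forall_isIntegral_primeLocalization (E := E)
      (fun 𝔭 h𝔭 h𝔭' => ((krull ⟨𝔭, h𝔭, h𝔭'⟩).isIntegral_iff f).2 fun i => hf ⟨_, i⟩)
      (Algebra.IsIntegral.isIntegral f)
  · have : Algebra.IsAlgebraic B L :=
      have := IsLocalization.isAlgebraic E (nonZeroDivisors B)
      Algebra.IsAlgebraic.trans B E L
    classical
    -- Away from a common denominator `b` of `f` and `f⁻¹`, both are integral.
    obtain ⟨b, hb, hbf⟩ := Algebra.IsAlgebraic.exists_integral_multiples B {f, f⁻¹}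
    have eq_one (𝔭 : T) (hmem : b ∉ 𝔭.1) (i : ι 𝔭) : w 𝔭 i f = 1 := by
      have le_one {z : L} (hz : IsIntegral B (b • z)) : w 𝔭 i z ≤ 1 :=
        ((krull 𝔭).isIntegral_iff z).1 (isIntegral_primeLocalization_of_smul hmem hz) i
      exact Place.eq_one_of_le_one_of_inv_le_one _ hf (le_one (hbf _ (by simp)))
        (le_one (hbf _ (by simp)))
    have finite_primes : {𝔭 : T | b ∈ 𝔭.1}.Finite :=
      .of_finite_image ((finite_setOf_isPrime_isPrincipal_mem hb).subset <| by
        rintro _ ⟨𝔭, hmem, rfl⟩; exact ⟨𝔭.2.1, 𝔭.2.2, hmem⟩) Subtype.val_injective.injOn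
    refine (finite_primes.biUnion fun 𝔭 _ =>
      ((krull 𝔭).finite_ne_one f hf).image (Sigma.mk 𝔭)).subset ?_
    rintro ⟨𝔭, i⟩ hi
    simp only [Set.mem_iUnion]
    exact ⟨𝔭, by_contra fun h => hi (eq_one 𝔭 h i), i, hi, rfl⟩

/-- A real-valued function that turns products of nonzero elements into sums, such as the integral
of `v ↦ v.val f` over a set of places. -/
def IsLogarithmic {F : Type*} [Field F] (φ : F → ℝ) : Prop :=
  ∀ f g, f ≠ 0 → g ≠ 0 → φ (f * g) = φ f + φ g

namespace IsLogarithmic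

variable {F : Type*} [Field F] {φ : F → ℝ} {f : F}

theorem map_one (hφ : IsLogarithmic φ) : φ 1 = 0 := by
  simpa using hφ 1 1 one_ne_zero one_ne_zero

theorem map_inv (hφ : IsLogarithmic φ) (hf : f ≠ 0) : φ f⁻¹ = -φ f := by
  have := hφ f f⁻¹ hf (inv_ne_zero hf)
  rw [mul_inv_cancel₀ hf, hφ.map_one] at this
  linarith

theorem map_pow (hφ : IsLogarithmic φ) (hf : f ≠ 0) (k : ℕ) : φ (f ^ k) = k * φ f := by
  induction k with
  | zero => simpa using hφ.map_one
  | succ k ih =>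
    rw [pow_succ, hφ _ _ (pow_ne_zero k hf) hf, ih]
    push_cast
    ring

-- An integral element is almost integral: `φ r + k * φ f ≥ 0` for a fixed `r` and all `k`.
theorem nonneg_of_isIntegral {R : Type*} [CommRing R] [IsDomain R] [Algebra R F]
    [IsFractionRing R F] (hφ : IsLogarithmic φ)
    (hR : ∀ r : R, r ≠ 0 → 0 ≤ φ (algebraMap R F r)) (hf : f ≠ 0) (hf_int : IsIntegral R f) :
    0 ≤ φ f := by
  obtain ⟨r, hr, hrf⟩ := hf_int.isAlmostIntegral
  have r_ne_zero : algebraMap R F r ≠ 0 :=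
    (map_ne_zero_iff _ (IsFractionRing.injective R F)).2 (nonZeroDivisors.ne_zero hr)
  have add_mul_nonneg (k : ℕ) : 0 ≤ φ (algebraMap R F r) + k * φ f := by
    obtain ⟨g, hg⟩ := hrf k
    rw [Algebra.smul_def] at hg
    have g_ne_zero : g ≠ 0 := by
      rintro rfl
      rw [map_zero] at hg
      exact mul_ne_zero r_ne_zero (pow_ne_zero k hf) hg.symm
    rw [← hφ.map_pow hf, ← hφ _ _ r_ne_zero (pow_ne_zero k hf), ← hg]
    exact hR g g_ne_zero
  by_contra! hneg
  obtain ⟨k, hk⟩ := exists_nat_gt (φ (algebraMap R F r) / -φ f)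
  rw [div_lt_iff₀ (by linarith)] at hk
  linarith [add_mul_nonneg k]

end IsLogarithmic

namespace Place

variable {F : Type*} [Field F]

theorem isLogarithmic_val (v : Place F) : IsLogarithmic v.val := fun f g hf hg => by
  rw [val, v.mul, Real.log_mul (v.pos_of_ne_zero hf).ne' (v.pos_of_ne_zero hg).ne', val, val]
  ring

end Place

section Frobenius

variable {L F : Type*} [Field L] [Field F] [Algebra L F] {ι : Type*} {w : ι → Place L}
  {ψ : F →+* L} {q : ℕ}

theorem Place.IsRepresentativeFamily.comap_of_pow (hw : IsRepresentativeFamily w) (hq : q ≠ 0)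
    (hψ : ∀ f, ψ (algebraMap L F f) = f ^ q) :
    IsRepresentativeFamily fun i => (w i).comap ψ := by
  have comap_apply (i : ι) (f : L) : (w i).comap ψ (algebraMap L F f) = w i f ^ q := by
    rw [← map_pow, ← hψ]
    rfl
  refine ⟨fun i htriv => hw.nontrivial i fun f hf => ?_, fun i j hij => ?_⟩
  · have := htriv (algebraMap L F f) ((map_ne_zero _).2 hf)
    rwa [comap_apply, pow_eq_one_iff_of_nonneg ((w i).nonneg f) hq] at this
  · obtain ⟨s, hs, h⟩ := hij
    have equiv : (w i).Equivalent (w j) := ⟨s, hs, fun a => by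
      have := h (algebraMap L F a)
      rw [comap_apply, comap_apply, ← Real.rpow_natCast_mul ((w i).nonneg a), mul_comm,
        Real.rpow_mul_natCast ((w i).nonneg a)] at this
      exact (pow_left_inj₀ ((w j).nonneg a) (Real.rpow_nonneg ((w i).nonneg a) s) hq).1 this⟩
    exact congrArg (comap ψ) (hw.eq_of_equivalent i j equiv)

theorem IsKrullFamily.comap_of_pow {B : Type*} [CommRing B] [Algebra B L] [Algebra B F]
    [IsScalarTower B L F] (hw : IsKrullFamily B w) (hq : q ≠ 0)
    (hψ : ∀ f, algebraMap L F (ψ f) = f ^ q) : IsKrullFamily B fun i => (w i).comap ψ := by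
  refine ⟨fun f => ?_, fun f hf => hw.finite_ne_one (ψ f) ((map_ne_zero ψ).2 hf)⟩
  have : IsIntegral B (ψ f) ↔ IsIntegral B f := by
    rw [← isIntegral_algebraMap_iff (algebraMap L F).injective, hψ]
    exact ⟨fun h => h.of_pow (Nat.pos_of_ne_zero hq), fun h => h.pow q⟩
  rw [← this, hw.isIntegral_iff]
  rfl

end Frobenius

theorem exists_isKrullFamily_of_finiteDimensional {B : Type uB} {E : Type uE} {F : Type uL}
    [CommRing B] [IsDomain B] [UniqueFactorizationMonoid B] [IsNoetherianRing B] [Field E]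
    [Algebra B E] [IsFractionRing B E] [Field F] [Algebra E F] [Algebra B F] [IsScalarTower B E F]
    [FiniteDimensional E F] :
    ∃ (ι : Type max uB uL) (w : ι → Place F), IsKrullFamily B w ∧
      Place.IsRepresentativeFamily w := by
  let L := separableClosure E F
  have : IsScalarTower B L F := .of_algebraMap_eq fun b => by
    rw [IsScalarTower.algebraMap_apply B E F, IsScalarTower.algebraMap_apply B E L]
    rfl
  obtain ⟨ι, w, krull, normalized⟩ := exists_isKrullFamily_of_isSeparable (B := B) (E := E) (L := L)
  -- A power of Frobenius maps `F` back to `L`.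
  have q_ne_zero : ringExpChar L ^ IsPurelyInseparable.exponent L F ≠ 0 :=
    pow_ne_zero _ (expChar_pos L (ringExpChar L)).ne'
  exact ⟨ι, fun i => (w i).comap (IsPurelyInseparable.iterateFrobenius L F (ringExpChar L) le_rfl),
    krull.comap_of_pow q_ne_zero (IsPurelyInseparable.algebraMap_iterateFrobenius L _ _),
    (Place.isRepresentativeFamily_of_isNormalized normalized).comap_of_pow q_ne_zero
      (IsPurelyInseparable.iterateFrobenius_algebraMap F _ _)⟩

theorem exists_isKrullFamily_of_finiteType {K : Type uB} {R : Type uE} {F : Type uL} [Field K]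
    [CommRing R] [IsDomain R] [Field F] [Algebra K R] [Algebra.FiniteType K R] [Algebra R F]
    [IsFractionRing R F] :
    ∃ (ι : Type max uB uL) (w : ι → Place F), IsKrullFamily R w ∧
      Place.IsRepresentativeFamily w := by
  obtain ⟨s, g, hg, g_finite⟩ := exists_finite_inj_algHom_of_fg K R
  let B := MvPolynomial (Fin s) K
  let _ : Algebra B R := g.toRingHom.toAlgebra
  have : Module.Finite B R := g_finite
  have : FaithfulSMul B R := (faithfulSMul_iff_algebraMap_injective _ _).2 hg
  let _ : Algebra B F := ((algebraMap R F).comp (algebraMap B R)).toAlgebra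
  have : IsScalarTower B R F := .of_algebraMap_eq' rfl
  have : FaithfulSMul B F := (faithfulSMul_iff_algebraMap_injective B F).2
    ((IsFractionRing.injective R F).comp (FaithfulSMul.algebraMap_injective B R))
  let E := FractionRing B
  let _ : Algebra E F := FractionRing.liftAlgebra B F
  have : IsScalarTower B E F := FractionRing.isScalarTower_liftAlgebra B F
  have : FiniteDimensional E F := .of_isLocalization B R (nonZeroDivisors B)
  obtain ⟨ι, w, krull, reps⟩ :=
    exists_isKrullFamily_of_finiteDimensional (B := B) (E := E) (F := F)
  refine ⟨ι, w, ⟨fun f => ?_, krull.finite_ne_one⟩, reps⟩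
  rw [← krull.isIntegral_iff]
  exact ⟨isIntegral_trans f, IsIntegral.tower_top⟩

namespace IsKrullFamily

variable {B L ι : Type*} [CommRing B] [Field L] [Algebra B L] {w : ι → Place L}

theorem le_one (hw : IsKrullFamily B w) (b : B) (i : ι) : w i (algebraMap B L b) ≤ 1 :=
  (hw.isIntegral_iff _).1 isIntegral_algebraMap i

theorem finite_support_val (hw : IsKrullFamily B w) {f : L} (hf : f ≠ 0) :
    (Function.support fun i => (w i).val f).Finite :=
  (hw.finite_ne_one f hf).subset fun i hi => ((w i).val_ne_zero_iff hf).1 hi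

theorem exists_val_pos [IsDomain B] [FaithfulSMul B L] [Algebra.IsAlgebraic B L]
    (hw : IsKrullFamily B w) {i : ι} (hi : ¬ (w i).IsTrivial) :
    ∃ g ≠ 0, (∀ j, 0 ≤ (w j).val g) ∧ 0 < (w i).val g := by
  obtain ⟨f, -, one_lt⟩ := Place.exists_one_lt_of_not_isTrivial hi
  obtain ⟨b, hb, hbf⟩ := Algebra.IsAlgebraic.exists_integral_multiples B {f}
  have b_ne_zero : algebraMap B L b ≠ 0 :=
    (map_ne_zero_iff _ (FaithfulSMul.algebraMap_injective B L)).2 hb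
  have b_mul_f_le_one := (hw.isIntegral_iff _).1 (hbf f (by simp)) i
  rw [Algebra.smul_def, Place.mul] at b_mul_f_le_one
  refine ⟨algebraMap B L b, b_ne_zero, fun j => (w j).val_nonneg_iff.2 (hw.le_one b j), ?_⟩
  have pos := (w i).pos_of_ne_zero b_ne_zero
  exact neg_pos.2 (Real.log_neg pos (by nlinarith))

theorem exists_abs_le_val [IsDomain B] [FaithfulSMul B L] [Algebra.IsAlgebraic B L]
    (hw : IsKrullFamily B w) (hw' : ∀ i, ¬ (w i).IsTrivial) (e : ι →₀ ℝ) :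
    ∃ g ≠ 0, ∀ i, |e i| ≤ (w i).val g := by
  induction e using Finsupp.induction_linear with
  | zero => exact ⟨1, one_ne_zero, fun i => by simp [(w i).isLogarithmic_val.map_one]⟩
  | add e e' he he' =>
    obtain ⟨g, hg, h⟩ := he
    obtain ⟨g', hg', h'⟩ := he'
    refine ⟨g * g', mul_ne_zero hg hg', fun i => ?_⟩
    rw [(w i).isLogarithmic_val _ _ hg hg']
    exact (abs_add_le _ _).trans (add_le_add (h i) (h' i))
  | single i a =>
    obtain ⟨g, hg, nonneg, pos⟩ := hw.exists_val_pos (hw' i)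
    obtain ⟨k, hk⟩ := exists_nat_gt (|a| / (w i).val g)
    rw [div_lt_iff₀ pos] at hk
    classical
    refine ⟨g ^ k, pow_ne_zero k hg, fun j => ?_⟩
    rw [(w j).isLogarithmic_val.map_pow hg, Finsupp.single_apply]
    split_ifs with h
    · exact h ▸ hk.le
    · rw [abs_zero]
      exact mul_nonneg k.cast_nonneg (nonneg j)

end IsKrullFamily

section Weights

variable {F ι : Type*} [Field F]

/-- The upper bounds `(e, t)` of the pairs `(div f, -φ f)`, `f ≠ 0`: a linear form `Λ` agrees with
`φ` on principal divisors as soon as `Λ e + t ≥ 0` on all of them. -/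
def divisorConstraints (w : ι → Place F) {φ : F → ℝ} (hφ : IsLogarithmic φ) :
    AddSubmonoid ((ι →₀ ℝ) × ℝ) where
  carrier := {x | ∃ f ≠ 0, (∀ i, (w i).val f ≤ x.1 i) ∧ -φ f ≤ x.2}
  add_mem' := by
    rintro x y ⟨f, hf, hx, hx'⟩ ⟨g, hg, hy, hy'⟩
    refine ⟨f * g, mul_ne_zero hf hg, fun i => ?_, ?_⟩
    · rw [(w i).isLogarithmic_val _ _ hf hg]
      exact add_le_add (hx i) (hy i)
    · rw [hφ f g hf hg, Prod.snd_add]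
      linarith
  zero_mem' := ⟨1, one_ne_zero, fun i => by simp [(w i).isLogarithmic_val.map_one],
    by simp [hφ.map_one]⟩

theorem exists_linearMap_eq_on_val {w : ι → Place F} {φ : F → ℝ} (hφ : IsLogarithmic φ)
    (hnonneg : ∀ f ≠ 0, (∀ i, w i f ≤ 1) → 0 ≤ φ f)
    (hdom : ∀ e : ι →₀ ℝ, ∃ g ≠ 0, ∀ i, |e i| ≤ (w i).val g) :
    ∃ Λ : (ι →₀ ℝ) →ₗ[ℝ] ℝ, (∀ e, (∀ i, 0 ≤ e i) → 0 ≤ Λ e) ∧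
      ∀ f ≠ 0, ∀ d : ι →₀ ℝ, (∀ i, d i = (w i).val f) → Λ d = φ f := by
  obtain ⟨Λ, hΛ⟩ := exists_linearMap_of_constraints (Γ := divisorConstraints w hφ)
    (fun e t t' htt' ⟨f, hf, he, ht⟩ => ⟨f, hf, he, ht.trans htt'⟩)
    (fun t ⟨f, hf, he, ht⟩ => by
      have := hnonneg f⁻¹ (inv_ne_zero hf) fun i => by
        rw [← Place.val_nonneg_iff, (w i).isLogarithmic_val.map_inv hf]
        exact neg_nonneg.2 (he i)
      rw [hφ.map_inv hf] at this
      exact this.trans ht)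
    (fun e => by
      obtain ⟨g, hg, hge⟩ := hdom e
      refine ⟨φ g, fun r hr hr' => ⟨g⁻¹, inv_ne_zero hg, fun i => ?_, by simp [hφ.map_inv hg]⟩⟩
      rw [(w i).isLogarithmic_val.map_inv hg, Finsupp.smul_apply, smul_eq_mul]
      nlinarith [hge i, abs_nonneg (e i), neg_abs_le (e i)])
  refine ⟨Λ, fun e he => ?_, fun f hf d hd => ?_⟩
  · simpa using hΛ e 0 ⟨1, one_ne_zero, fun i => by
      rw [(w i).isLogarithmic_val.map_one]; exact he i, by simp [hφ.map_one]⟩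
  · have lower := hΛ d (-φ f) ⟨f, hf, fun i => (hd i).ge, le_rfl⟩
    have upper := hΛ (-d) (φ f) ⟨f⁻¹, inv_ne_zero hf, fun i => by
      rw [(w i).isLogarithmic_val.map_inv hf, Finsupp.neg_apply, hd],
      by rw [hφ.map_inv hf, neg_neg]⟩
    rw [map_neg] at upper
    linarith

theorem linearMap_eq_finsum (Λ : (ι →₀ ℝ) →ₗ[ℝ] ℝ) (d : ι →₀ ℝ) :
    Λ d = ∑ᶠ i, Λ (Finsupp.single i 1) * d i := by
  rw [finsum_eq_sum_of_support_subset (s := d.support)]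
  · conv_lhs => rw [← Finsupp.sum_single d, Finsupp.sum, map_sum]
    refine Finset.sum_congr rfl fun i _ => ?_
    rw [← mul_one (d i), ← smul_eq_mul, ← Finsupp.smul_single, map_smul, smul_eq_mul, smul_eq_mul,
      mul_one, mul_comm]
  · intro i hi
    rw [Finset.mem_coe, Finsupp.mem_support_iff]
    exact right_ne_zero_of_mul hi

theorem IsKrullFamily.exists_weights {B : Type*} [CommRing B] [IsDomain B] [Algebra B F]
    [FaithfulSMul B F] [Algebra.IsAlgebraic B F] {w : ι → Place F} (hw : IsKrullFamily B w)
    (hw' : ∀ i, ¬ (w i).IsTrivial) {φ : F → ℝ} (hφ : IsLogarithmic φ)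
    (hnonneg : ∀ f ≠ 0, IsIntegral B f → 0 ≤ φ f) :
    ∃ c : ι → ℝ, (∀ i, 0 ≤ c i) ∧ ∀ f ≠ 0, φ f = ∑ᶠ i, c i * (w i).val f := by
  obtain ⟨Λ, Λ_nonneg, Λ_eq⟩ := exists_linearMap_eq_on_val hφ
    (fun f hf h => hnonneg f hf ((hw.isIntegral_iff f).2 h)) (hw.exists_abs_le_val hw')
  refine ⟨fun i => Λ (Finsupp.single i 1), fun i => Λ_nonneg _ ?_, fun f hf => ?_⟩
  · exact (Finsupp.single_nonneg.2 zero_le_one : (0 : ι →₀ ℝ) ≤ _)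
  · rw [← Λ_eq f hf (Finsupp.ofSupportFinite _ (hw.finite_support_val hf)) fun _ => rfl,
      linearMap_eq_finsum]
    rfl

end Weights

theorem exists_divisorial_representation (K : Type uB) {R : Type uE} {F : Type uL} [Field K]
    [CommRing R] [IsDomain R] [Field F] [Algebra K R] [Algebra.FiniteType K R] [Algebra R F]
    [IsFractionRing R F] {φ : F → ℝ} (hφ : IsLogarithmic φ)
    (hnonneg : ∀ f : R, f ≠ 0 → 0 ≤ φ (algebraMap R F f)) :
    ∃ (ι : Type max uB uL) (w : ι → Place F) (c : ι → ℝ), IsKrullFamily R w ∧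
      Place.IsRepresentativeFamily w ∧ (∀ i, 0 ≤ c i) ∧
      ∀ f ≠ 0, φ f = ∑ᶠ i, c i * (w i).val f := by
  obtain ⟨ι, w, krull, reps⟩ := exists_isKrullFamily_of_finiteType (K := K) (R := R) (F := F)
  have : Algebra.IsAlgebraic R F := IsLocalization.isAlgebraic F (nonZeroDivisors R)
  have : FaithfulSMul R F :=
    (faithfulSMul_iff_algebraMap_injective R F).2 (IsFractionRing.injective R F)
  obtain ⟨c, c_nonneg, hc⟩ := krull.exists_weights reps.nontrivial hφ
    fun f hf h => hφ.nonneg_of_isIntegral hnonneg hf h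
  exact ⟨ι, w, c, krull, reps, c_nonneg, hc⟩

section Fibred

variable {T Y : Type*} {π : Y → T} {Z : Set Y} {C E : Set T}

/-- Functions on the part of `Z` above `C`, cut off outside `E ⊆ C` and extended by `0`. -/
noncomputable def extendCutoff (π : Y → T) (Z : Set Y) (C E : Set T) :
    (↥(Z ∩ π ⁻¹' C) → ℝ) →ₗ[ℝ] (Z → ℝ) :=
  LinearMap.mulLeft ℝ (fun v : Z => E.indicator (1 : T → ℝ) (π v)) ∘ₗ
    Function.ExtendByZero.linearMap ℝ (Set.inclusion Set.inter_subset_left)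

theorem extendCutoff_apply_of_mem (g : ↥(Z ∩ π ⁻¹' C) → ℝ) {v : Z} (hC : π v ∈ C) :
    extendCutoff π Z C E g v = E.indicator 1 (π v) * g ⟨v, v.2, hC⟩ :=
  congrArg (E.indicator 1 (π v) * ·)
    ((Set.inclusion_injective Set.inter_subset_left).extend_apply g 0 ⟨v, v.2, hC⟩)

theorem extendCutoff_apply (hEC : E ⊆ C) (g : Y → ℝ) :
    extendCutoff π Z C E (fun v => g v) = fun v : Z => E.indicator 1 (π v) * g v := by
  funext v
  by_cases h : π v ∈ E
  · exact extendCutoff_apply_of_mem _ (hEC h)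
  · simp [extendCutoff, h]

theorem extendCutoff_nonneg {g : ↥(Z ∩ π ⁻¹' C) → ℝ} (hg : 0 ≤ g) (v : Z) :
    0 ≤ extendCutoff π Z C E g v := by
  by_cases h : π v ∈ C
  · rw [extendCutoff_apply_of_mem g h]
    exact mul_nonneg (Set.indicator_apply_nonneg fun _ => zero_le_one' ℝ) (hg _)
  · refine (mul_eq_zero_of_right _ (Function.extend_apply' g (0 : Z → ℝ) v ?_)).ge
    rintro ⟨w, rfl⟩
    exact h w.2.2

theorem indicator_eq_sum_indicator_disjointed {C : ℕ → Set T} (hC : Monotone C) (N : ℕ) (p : T) :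
    (C N).indicator (1 : T → ℝ) p =
      ∑ j ∈ Finset.range (N + 1), (disjointed C j).indicator 1 p := by
  rw [← Finset.indicator_biUnion_apply _ _ fun i _ j _ hij => disjoint_disjointed C hij,
    biUnion_range_succ_disjointed, hC.partialSups_eq]

variable [MeasurableSpace T] {μ : Measure T}

/-- The functions on `Z` that are bounded on each fibre of `π` by the value of an integrable
function on the base. -/
def baseDominated (μ : Measure T) (π : Y → T) (Z : Set Y) : Submodule ℝ (Z → ℝ) where
  carrier := {e | ∃ b : T → ℝ, Integrable b μ ∧ ∀ v : Z, |e v| ≤ b (π v)}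
  add_mem' := by
    rintro e e' ⟨b, hb, h⟩ ⟨b', hb', h'⟩
    exact ⟨b + b', hb.add hb', fun v => (abs_add_le _ _).trans (add_le_add (h v) (h' v))⟩
  zero_mem' := ⟨0, integrable_zero _ _ _, fun v => by simp⟩
  smul_mem' := by
    rintro r e ⟨b, hb, h⟩
    refine ⟨fun p => |r| * b p, hb.const_mul _, fun v => ?_⟩
    rw [Pi.smul_apply, smul_eq_mul, abs_mul]
    exact mul_le_mul_of_nonneg_left (h v) (abs_nonneg r)

theorem comp_mem_baseDominated {h : T → ℝ} (hh : Integrable h μ) :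
    (fun v : Z => h (π v)) ∈ baseDominated μ π Z :=
  ⟨fun p => |h p|, hh.abs, fun _ => le_rfl⟩

theorem indicator_mul_mem_baseDominated (hE : MeasurableSet E) (hμE : μ E ≠ ⊤) {e : Z → ℝ} {M : ℝ}
    (he : ∀ v : Z, π v ∈ E → |e v| ≤ M) :
    (fun v : Z => E.indicator 1 (π v) * e v) ∈ baseDominated μ π Z := by
  refine ⟨E.indicator fun _ => M, (integrable_indicator_iff hE).2 (integrableOn_const hμE),
    fun v => ?_⟩
  by_cases h : π v ∈ E
  · simpa [h] using he v h
  · simp [h]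

/-- A linear functional that behaves like integration against a measure on `Z` lying above `μ`: it
is positive on dominated functions and is integration against `μ` on functions from the base. No
continuity along increasing sequences is required. -/
structure IsCompatible (μ : Measure T) (π : Y → T) (Z : Set Y) (Λ : (Z → ℝ) →ₗ[ℝ] ℝ) : Prop where
  nonneg : ∀ e ∈ baseDominated μ π Z, (∀ v, 0 ≤ e v) → 0 ≤ Λ e
  base : ∀ h : T → ℝ, Integrable h μ → Λ (fun v => h (π v)) = ∫ p, h p ∂μ

theorem extendCutoff_mem_baseDominated [TopologicalSpace Y] (hE : MeasurableSet E)
    (hEC : E ⊆ C) (hμE : μ E ≠ ⊤) (hZC : IsCompact (Z ∩ π ⁻¹' C)) {g : ↥(Z ∩ π ⁻¹' C) → ℝ}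
    (hg : Continuous g) : extendCutoff π Z C E g ∈ baseDominated μ π Z := by
  have : CompactSpace ↥(Z ∩ π ⁻¹' C) := isCompact_iff_compactSpace.1 hZC
  obtain ⟨M, hM⟩ := isCompact_univ.exists_bound_of_continuousOn (s := Set.univ) hg.continuousOn
  refine indicator_mul_mem_baseDominated (M := M) hE hμE fun v hv => ?_
  have extend_eq := (Set.inclusion_injective Set.inter_subset_left).extend_apply g 0
    ⟨v, v.2, hEC hv⟩
  exact (congrArg norm extend_eq).trans_le (hM _ trivial)

theorem IsCompatible.exists_isFiniteMeasure [TopologicalSpace Y] [T2Space Y] [MeasurableSpace Y]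
    [BorelSpace Y] {Λ : (Z → ℝ) →ₗ[ℝ] ℝ} (hΛ : IsCompatible μ π Z Λ) (hE : MeasurableSet E)
    (hEC : E ⊆ C) (hμE : μ E ≠ ⊤) (hZC : IsCompact (Z ∩ π ⁻¹' C)) :
    ∃ ν : Measure Y, IsFiniteMeasure ν ∧ ν (Z ∩ π ⁻¹' C)ᶜ = 0 ∧ ∀ g : Y → ℝ, Continuous g →
      Integrable g ν ∧ ∫ v, g v ∂ν = Λ (fun v => E.indicator 1 (π v) * g v) := by
  set W := Z ∩ π ⁻¹' C
  have : CompactSpace W := isCompact_iff_compactSpace.1 hZC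
  let Ψ : CompactlySupportedContinuousMap W ℝ →ₚ[ℝ] ℝ := PositiveLinearMap.mk₀
    { toFun := fun g => Λ (extendCutoff π Z C E g)
      map_add' := fun g g' => by rw [← map_add, ← map_add]; rfl
      map_smul' := fun r g => by rw [RingHom.id_apply, ← map_smul, ← map_smul]; rfl }
    fun g hg => hΛ.nonneg _ (extendCutoff_mem_baseDominated hE hEC hμE hZC g.continuous)
      (extendCutoff_nonneg hg)
  have := RealRMK.regular_rieszMeasure Ψ
  have : IsFiniteMeasure (RealRMK.rieszMeasure Ψ) := CompactSpace.isFiniteMeasure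
  have emb : MeasurableEmbedding (Subtype.val : W → Y) :=
    MeasurableEmbedding.subtype_coe hZC.measurableSet
  refine ⟨(RealRMK.rieszMeasure Ψ).map Subtype.val, inferInstance, ?_, fun g hg => ⟨?_, ?_⟩⟩
  · rw [emb.map_apply]
    simp
  · rw [emb.integrable_map_iff]
    exact (hg.comp continuous_subtype_val).integrable_of_hasCompactSupport
      (HasCompactSupport.of_compactSpace _)
  · rw [emb.integral_map, ← extendCutoff_apply hEC]
    exact RealRMK.integral_rieszMeasure Ψ
      ⟨⟨fun v : W => g v, hg.comp continuous_subtype_val⟩, HasCompactSupport.of_compactSpace _⟩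

theorem IsCompatible.map_eq_restrict [TopologicalSpace T] [BorelSpace T] [HasOuterApproxClosed T]
    [TopologicalSpace Y] [MeasurableSpace Y] [BorelSpace Y] (hπ : Continuous π)
    {Λ : (Z → ℝ) →ₗ[ℝ] ℝ} (hΛ : IsCompatible μ π Z Λ) (hE : MeasurableSet E) (hμE : μ E ≠ ⊤)
    {ν : Measure Y} [IsFiniteMeasure ν]
    (hν : ∀ g : Y → ℝ, Continuous g → ∫ v, g v ∂ν = Λ (fun v => E.indicator 1 (π v) * g v)) :
    ν.map π = μ.restrict E := by
  have : IsFiniteMeasure (μ.restrict E) := ⟨by simpa using hμE.lt_top⟩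
  refine ext_of_forall_integral_eq_of_IsFiniteMeasure fun g => ?_
  have indicator_integrable : Integrable (E.indicator g) μ :=
    (integrable_indicator_iff hE).2 (g.integrable _)
  rw [integral_map hπ.measurable.aemeasurable g.continuous.aestronglyMeasurable,
    hν (fun v => g (π v)) (g.continuous.comp hπ), ← integral_indicator hE,
    ← hΛ.base _ indicator_integrable]
  congr 1
  funext v
  by_cases h : π v ∈ E <;> simp [h]

theorem sum_restrict_preimage_of_map_eq [MeasurableSpace Y] (hπ : Measurable π) {C : ℕ → Set T}
    (hC : ∀ j, MeasurableSet (C j)) (hC_mono : Monotone C) {ν : ℕ → Measure Y}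
    (hν : ∀ j, (ν j).map π = μ.restrict (disjointed C j)) (N : ℕ) :
    (Measure.sum ν).restrict (π ⁻¹' C N) = ∑ j ∈ Finset.range (N + 1), ν j := by
  have restrict_of_le {j : ℕ} (hj : j ≤ N) : (ν j).restrict (π ⁻¹' C N) = ν j := by
    refine Measure.restrict_eq_self_of_ae_mem (ae_of_ae_map hπ.aemeasurable (p := (· ∈ C N)) ?_)
    rw [hν]
    filter_upwards [ae_restrict_mem (MeasurableSet.disjointed hC j)] with p hp
    exact hC_mono hj (disjointed_subset C j hp)
  have restrict_of_lt {j : ℕ} (hj : N < j) : (ν j).restrict (π ⁻¹' C N) = 0 := by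
    rw [Measure.restrict_eq_zero, ← Measure.map_apply hπ (hC N), hν, Measure.restrict_apply (hC N),
      disjointed_eq_inter_compl]
    exact measure_mono_null
      (fun p hp => (Set.mem_iInter₂.1 hp.2.2 N hj hp.1).elim) measure_empty
  rw [Measure.restrict_sum ν (hπ (hC N))]
  ext1 s hs
  rw [Measure.sum_apply _ hs, Measure.finsetSum_apply, tsum_eq_sum fun j hj => ?_]
  · exact Finset.sum_congr rfl fun j hj => by
      rw [restrict_of_le (Finset.mem_range_succ_iff.1 hj)]
  · rw [restrict_of_lt (by simpa using hj), Measure.coe_zero, Pi.zero_apply]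

theorem IsCompatible.exists_measure [TopologicalSpace T] [BorelSpace T] [HasOuterApproxClosed T]
    [TopologicalSpace Y] [T2Space Y] [MeasurableSpace Y] [BorelSpace Y] (hπ : Continuous π)
    (hZ : MeasurableSet Z) {Λ : (Z → ℝ) →ₗ[ℝ] ℝ} (hΛ : IsCompatible μ π Z Λ) {C : ℕ → Set T}
    (hC : ∀ j, MeasurableSet (C j)) (hC_mono : Monotone C) (hμC : ∀ j, μ (C j) ≠ ⊤)
    (hZC : ∀ j, IsCompact (Z ∩ π ⁻¹' C j)) (hcover : ∀ᵐ p ∂μ, ∃ j, p ∈ C j) :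
    ∃ ν : Measure Y, ν.map π = μ ∧ (∀ᵐ v ∂ν, v ∈ Z) ∧ ∀ N, ∀ g : Y → ℝ, Continuous g →
      IntegrableOn g (π ⁻¹' C N) ν ∧
        ∫ v in π ⁻¹' C N, g v ∂ν = Λ fun v => (C N).indicator 1 (π v) * g v := by
  have E_measurable (j : ℕ) : MeasurableSet (disjointed C j) := .disjointed hC j
  have μE_ne_top (j : ℕ) : μ (disjointed C j) ≠ ⊤ :=
    ne_top_of_le_ne_top (hμC j) (measure_mono (disjointed_subset C j))
  choose ν ν_finite ν_compl integral_ν using fun j =>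
    hΛ.exists_isFiniteMeasure (E_measurable j) (disjointed_subset C j) (μE_ne_top j) (hZC j)
  have map_ν (j : ℕ) : (ν j).map π = μ.restrict (disjointed C j) :=
    hΛ.map_eq_restrict hπ (E_measurable j) (μE_ne_top j) fun g hg => (integral_ν j g hg).2
  refine ⟨Measure.sum ν, ?_, ?_, fun N g hg => ?_⟩
  · rw [Measure.map_sum hπ.measurable.aemeasurable]
    simp_rw [map_ν]
    rw [← Measure.restrict_iUnion (disjoint_disjointed C) E_measurable, iUnion_disjointed]
    exact Measure.restrict_eq_self_of_ae_mem (by simpa using hcover)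
  · refine (Measure.ae_sum_iff' hZ).2 fun j => ?_
    exact measure_mono_null (Set.compl_subset_compl.2 Set.inter_subset_left) (ν_compl j)
  · have integrable_g (j : ℕ) (_ : j ∈ Finset.range (N + 1)) : Integrable g (ν j) :=
      (integral_ν j g hg).1
    rw [IntegrableOn, sum_restrict_preimage_of_map_eq hπ.measurable hC hC_mono map_ν N,
      integral_finsetSum_measure integrable_g, integrable_finsetSum_measure]
    refine ⟨integrable_g, ?_⟩
    simp_rw [fun j => (integral_ν j g hg).2, indicator_eq_sum_indicator_disjointed hC_mono N,
      ← map_sum]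
    congr 1
    funext v
    rw [Finset.sum_apply, Finset.sum_mul]

end Fibred

section Lintegral

variable {Y : Type*} [MeasurableSpace Y] {ν : Measure Y}

theorem lintegral_ofReal_le_of_integral_le {g : Y → ℝ} {d : ℝ} {P : ENNReal} (hg : Integrable g ν)
    (hd : ∫ v, g v ∂ν ≤ d) (hP : ∫⁻ v, ENNReal.ofReal (-g v) ∂ν ≤ P) :
    ∫⁻ v, ENNReal.ofReal (g v) ∂ν ≤ P + ENNReal.ofReal d := by
  rw [integral_eq_lintegral_pos_part_sub_lintegral_neg_part hg, sub_le_iff_le_add'] at hd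
  calc ∫⁻ v, ENNReal.ofReal (g v) ∂ν
      = ENNReal.ofReal (∫⁻ v, ENNReal.ofReal (g v) ∂ν).toReal :=
        (ENNReal.ofReal_toReal hg.lintegral_lt_top.ne).symm
    _ ≤ ENNReal.ofReal ((∫⁻ v, ENNReal.ofReal (-g v) ∂ν).toReal + d) :=
        ENNReal.ofReal_le_ofReal hd
    _ ≤ ENNReal.ofReal (∫⁻ v, ENNReal.ofReal (-g v) ∂ν).toReal + ENNReal.ofReal d :=
        ENNReal.ofReal_add_le
    _ ≤ P + ENNReal.ofReal d := by
        gcongr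
        exact ENNReal.ofReal_toReal_le.trans hP

theorem integrable_of_lintegral_ofReal_neg_le {g : Y → ℝ} (hg : AEStronglyMeasurable g ν)
    (hpos : ∫⁻ v, ENNReal.ofReal (g v) ∂ν ≠ ⊤)
    (hneg : ∫⁻ v, ENNReal.ofReal (-g v) ∂ν ≤ ∫⁻ v, ENNReal.ofReal (g v) ∂ν) :
    Integrable g ν := by
  refine ⟨hg, (hasFiniteIntegral_iff_norm g).2 ?_⟩
  have norm_eq (v : Y) : ENNReal.ofReal ‖g v‖ = ENNReal.ofReal (g v) + ENNReal.ofReal (-g v) := by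
    rcases le_total 0 (g v) with h | h
    · rw [Real.norm_of_nonneg h, ENNReal.ofReal_of_nonpos (neg_nonpos.2 h), add_zero]
    · rw [Real.norm_of_nonpos h, ENNReal.ofReal_of_nonpos h, zero_add]
  simp_rw [norm_eq]
  rw [lintegral_add_left' hg.aemeasurable.ennreal_ofReal]
  exact ENNReal.add_lt_top.2 ⟨hpos.lt_top, hneg.trans_lt hpos.lt_top⟩

theorem lintegral_iSup_le_of_setLIntegral_le {D : ℕ → Set Y} (hD : ∀ N, MeasurableSet (D N))
    (hD_mono : Monotone D) (hcover : ∀ᵐ v ∂ν, ∃ N, v ∈ D N) {q : ℕ → Y → ENNReal}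
    (hq : ∀ N, Measurable (q N)) (hq_mono : Monotone q) {P : ENNReal} {δ : ℕ → ENNReal}
    (hδ : Tendsto δ atTop (𝓝 0)) (hle : ∀ N, ∫⁻ v in D N, q N v ∂ν ≤ P + δ N) :
    ∫⁻ v, ⨆ N, q N v ∂ν ≤ P := by
  have indicator_mono (v : Y) : Monotone fun N => (D N).indicator (q N) v := fun M N hMN =>
    (Set.indicator_le_indicator (hq_mono hMN v)).trans
      (Set.indicator_le_indicator_of_subset (hD_mono hMN) (fun _ => zero_le) v)
  have indicator_tendsto : ∀ᵐ v ∂ν,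
      Tendsto (fun N => (D N).indicator (q N) v) atTop (𝓝 (⨆ N, q N v)) := by
    filter_upwards [hcover] with v ⟨M, hM⟩
    refine (tendsto_atTop_iSup fun _ _ h => hq_mono h v).congr' ?_
    filter_upwards [eventually_ge_atTop M] with N hN
    exact (Set.indicator_of_mem (hD_mono hN hM) _).symm
  have lintegral_tendsto := lintegral_tendsto_of_tendsto_of_monotone
    (fun N => ((hq N).indicator (hD N)).aemeasurable) (.of_forall indicator_mono) indicator_tendsto
  refine le_of_tendsto_of_tendsto' lintegral_tendsto (by simpa using hδ.const_add P) fun N => ?_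
  rw [lintegral_indicator (hD N)]
  exact hle N

end Lintegral

section ProductInequality

variable {K R : Type*} [Field K] [CommRing R] [Algebra K R] {μ : Measure (Place K)}
  {Z : Set (Place R)}

theorem Place.continuous_res : Continuous (Place.res K : Place R → Place K) :=
  Place.continuous_comap _

/-- No nonzero `f` has order bounded below on `Z` by a function on the base with positive integral.
This is necessary for the existence of a measure on `Z` lying above `μ` for which `∫ ord f ≤ 0` for
all nonzero `f`. -/
def ProductInequality (μ : Measure (Place K)) (Z : Set (Place R)) : Prop :=
  ∀ f : R, f ≠ 0 → ∀ h : Place K → ℝ, Integrable h μ →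
    (∀ v ∈ Z, v f ≤ Real.exp (-h (v.res K))) → ∫ p, h p ∂μ ≤ 0

/-- The pairs `(e, t)` for which `0 ≤ Λ e + t` is forced on every `Λ` that is positive, restricts to
integration against `μ`, and satisfies `Λ e' ≤ 0` whenever `e'` is bounded above by the order of
some nonzero `f`. -/
def productConstraints [IsDomain R] (μ : Measure (Place K)) (Z : Set (Place R)) :
    AddSubmonoid (baseDominated μ (Place.res K) Z × ℝ) where
  carrier := {x | ∃ f : R, f ≠ 0 ∧ ∃ h : Place K → ℝ, Integrable h μ ∧
    (∀ v : Z, v.1 f ≤ Real.exp (x.1.1 v - h (v.1.res K))) ∧ -∫ p, h p ∂μ ≤ x.2}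
  add_mem' := by
    rintro x y ⟨f, hf, h, hh, hfx, hx⟩ ⟨f', hf', h', hh', hfy, hy⟩
    refine ⟨f * f', mul_ne_zero hf hf', h + h', hh.add hh', fun v => ?_, ?_⟩
    · rw [Place.mul]
      refine (mul_le_mul (hfx v) (hfy v) (v.1.nonneg _) (Real.exp_pos _).le).trans_eq ?_
      rw [← Real.exp_add]
      exact congrArg Real.exp (sub_add_sub_comm _ _ _ _)
    · rw [Prod.snd_add, integral_add' hh hh', neg_add]
      exact add_le_add hx hy
  zero_mem' := ⟨1, one_ne_zero, 0, integrable_zero _ _ _, fun v => by simp [Place.one], by simp⟩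

section Domain

variable [IsDomain R]

theorem mem_productConstraints_of_le {h : Place K → ℝ} (hh : Integrable h μ)
    {e : baseDominated μ (Place.res K) Z} (he : ∀ v : Z, h (v.1.res K) ≤ e.1 v) :
    (e, -∫ p, h p ∂μ) ∈ productConstraints μ Z :=
  ⟨1, one_ne_zero, h, hh, fun v => by simpa [Place.one] using he v, le_rfl⟩

theorem neg_mem_productConstraints {f : R} (hf : f ≠ 0) {e : baseDominated μ (Place.res K) Z}
    (he : ∀ v : Z, v.1 f ≤ Real.exp (-e.1 v)) : (-e, 0) ∈ productConstraints μ Z :=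
  ⟨f, hf, 0, integrable_zero _ _ _, fun v => by simpa using he v, by simp⟩

theorem ProductInequality.exists_linearMap (hZ : ProductInequality μ Z) :
    ∃ Λ : baseDominated μ (Place.res K) Z →ₗ[ℝ] ℝ,
      ∀ e t, (e, t) ∈ productConstraints μ Z → 0 ≤ Λ e + t := by
  refine exists_linearMap_of_constraints ?_ ?_ ?_
  · rintro e t t' htt' ⟨f, hf, h, hh, hfe, ht⟩
    exact ⟨f, hf, h, hh, hfe, ht.trans htt'⟩
  · rintro t ⟨f, hf, h, hh, hfe, ht⟩
    have integral_nonpos := hZ f hf h hh fun v hv => by simpa using hfe ⟨v, hv⟩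
    exact (neg_nonneg.2 integral_nonpos).trans ht
  · rintro ⟨e, b, hb, he⟩
    refine ⟨-∫ p, -b p ∂μ, fun r hr hr1 => mem_productConstraints_of_le hb.neg fun v => ?_⟩
    have abs_le : |r * e v| ≤ b (v.1.res K) := by
      rw [abs_mul, abs_of_nonneg hr]
      exact (mul_le_of_le_one_left (abs_nonneg _) hr1).trans (he v)
    exact neg_le_of_abs_le abs_le

theorem ProductInequality.exists_isCompatible (hZ : ProductInequality μ Z) :
    ∃ Λ : (Z → ℝ) →ₗ[ℝ] ℝ, IsCompatible μ (Place.res K) Z Λ ∧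
      ∀ f : R, f ≠ 0 → ∀ e ∈ baseDominated μ (Place.res K) Z,
        (∀ v : Z, v.1 f ≤ Real.exp (-e v)) → Λ e ≤ 0 := by
  obtain ⟨Λ, hΛ⟩ := hZ.exists_linearMap
  obtain ⟨Λ', hΛ'⟩ := LinearMap.exists_extend Λ
  have extend_eq (e) (he : e ∈ baseDominated μ (Place.res K) Z) : Λ' e = Λ ⟨e, he⟩ :=
    LinearMap.congr_fun hΛ' ⟨e, he⟩
  refine ⟨Λ', ⟨fun e he e_nonneg => ?_, fun h hh => ?_⟩, fun f hf e he hfe => ?_⟩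
  · have := hΛ ⟨e, he⟩ _ (mem_productConstraints_of_le (integrable_zero _ _ _) e_nonneg)
    simpa [extend_eq e he] using this
  · have h_mem : (fun v : Z => h (v.1.res K)) ∈ baseDominated μ (Place.res K) Z :=
      comp_mem_baseDominated hh
    have integral_le := hΛ ⟨_, h_mem⟩ _ (mem_productConstraints_of_le hh fun v => le_rfl)
    have le_integral := hΛ (-⟨_, h_mem⟩) _ (mem_productConstraints_of_le hh.neg fun v => le_rfl)
    rw [map_neg, integral_neg', neg_neg] at le_integral
    rw [extend_eq _ h_mem]
    linarith
  · have := hΛ (-⟨e, he⟩) 0 (neg_mem_productConstraints hf hfe)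
    simpa [extend_eq e he] using this

end Domain

/-- The order `-log (v f)`, truncated above at `N`; this makes it a continuous real function of `v`
also where `v f = 0`. -/
noncomputable def truncOrd (f : R) (N : ℕ) (v : Place R) : ℝ :=
  -Real.log (max (v f) (Real.exp (-N)))

theorem continuous_truncOrd (f : R) (N : ℕ) : Continuous (truncOrd f N) :=
  (Continuous.log ((Place.continuous_eval f).max continuous_const) fun _ =>
    (lt_max_of_lt_right (Real.exp_pos _)).ne').neg

theorem truncOrd_mono (f : R) (v : Place R) : Monotone fun N => truncOrd f N v := by
  intro M N hMN
  refine neg_le_neg (Real.log_le_log (lt_max_of_lt_right (Real.exp_pos _))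
    (max_le_max le_rfl (Real.exp_le_exp.2 ?_)))
  simpa using hMN

theorem apply_le_exp_neg_truncOrd (f : R) (N : ℕ) (v : Place R) :
    v f ≤ Real.exp (-truncOrd f N v) := by
  rw [truncOrd, neg_neg, Real.exp_log (lt_max_of_lt_right (Real.exp_pos _))]
  exact le_max_left _ _

theorem ofReal_neg_truncOrd_le (f : R) (N : ℕ) (v : Place R) :
    ENNReal.ofReal (-truncOrd f N v) ≤ ENNReal.ofReal (Real.log (v f)) := by
  rw [truncOrd, neg_neg]
  rcases le_total (v f) (Real.exp (-N)) with h | h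
  · rw [max_eq_right h, Real.log_exp, ENNReal.ofReal_of_nonpos (by simp)]
    exact zero_le
  · rw [max_eq_left h]

theorem iSup_ofReal_truncOrd_eq_top {f : R} {v : Place R} (h : v f = 0) :
    ⨆ N, ENNReal.ofReal (truncOrd f N v) = ⊤ := by
  refine ENNReal.eq_top_of_forall_nnreal_le fun r => ?_
  obtain ⟨N, hN⟩ := exists_nat_ge r
  refine le_iSup_of_le N ?_
  rw [truncOrd, h, max_eq_right (Real.exp_pos _).le, Real.log_exp, neg_neg, ENNReal.ofReal_natCast]
  exact_mod_cast hN

theorem ofReal_neg_log_le_iSup_ofReal_truncOrd (f : R) (v : Place R) :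
    ENNReal.ofReal (-Real.log (v f)) ≤ ⨆ N, ENNReal.ofReal (truncOrd f N v) := by
  rcases (v.nonneg f).eq_or_lt with h | h
  · simp [← h]
  · obtain ⟨N, hN⟩ := exists_nat_ge (-Real.log (v f))
    have exp_le : Real.exp (-N) ≤ v f := (Real.le_log_iff_exp_le h).1 (neg_le.1 hN)
    refine le_iSup_of_le N (le_of_eq ?_)
    rw [truncOrd, max_eq_left exp_le]

theorem integrable_log_of_lintegral_iSup_truncOrd_le {ν : Measure (Place R)} {f : R}
    (hfin : ∫⁻ v, ENNReal.ofReal (Real.log (v f)) ∂ν ≠ ⊤)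
    (hle : ∫⁻ v, ⨆ N, ENNReal.ofReal (truncOrd f N v) ∂ν ≤
      ∫⁻ v, ENNReal.ofReal (Real.log (v f)) ∂ν) :
    (∀ᵐ v ∂ν, v f ≠ 0) ∧ Integrable (fun v => Real.log (v f)) ν ∧
      0 ≤ ∫ v, Real.log (v f) ∂ν := by
  have iSup_measurable : Measurable fun v : Place R => ⨆ N, ENNReal.ofReal (truncOrd f N v) :=
    .iSup fun N => (continuous_truncOrd f N).measurable.ennreal_ofReal
  have neg_log_le : ∫⁻ v, ENNReal.ofReal (-Real.log (v f)) ∂ν ≤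
      ∫⁻ v, ENNReal.ofReal (Real.log (v f)) ∂ν :=
    (lintegral_mono fun v => ofReal_neg_log_le_iSup_ofReal_truncOrd f v).trans hle
  have integrable_log : Integrable (fun v : Place R => Real.log (v f)) ν :=
    integrable_of_lintegral_ofReal_neg_le
      (Place.measurable_eval f).log.aestronglyMeasurable hfin neg_log_le
  refine ⟨?_, integrable_log, ?_⟩
  · filter_upwards [ae_lt_top iSup_measurable (ne_top_of_le_ne_top hfin hle)] with v hv hvf
    exact hv.ne (iSup_ofReal_truncOrd_eq_top hvf)
  · rw [integral_eq_lintegral_pos_part_sub_lintegral_neg_part integrable_log, sub_nonneg]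
    exact ENNReal.toReal_mono hfin neg_log_le

theorem lintegral_ofReal_log_lt_top {ν : Measure (Place R)}
    (hνμ : ν.map (Place.res K) = μ) (hνZ : ∀ᵐ v ∂ν, v ∈ Z) {f : R} {H : Place K → ℝ}
    (hH : Integrable H μ) (hfH : ∀ v ∈ Z, v f ≤ Real.exp (H (v.res K))) :
    ∫⁻ v, ENNReal.ofReal (Real.log (v f)) ∂ν < ⊤ := by
  have hH_res : Integrable (fun v : Place R => H (v.res K)) ν :=
    (hνμ ▸ hH).comp_measurable Place.continuous_res.measurable
  refine (lintegral_mono_ae ?_).trans_lt hH_res.lintegral_lt_top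
  filter_upwards [hνZ] with v hv
  rcases (v.nonneg f).eq_or_lt with h | h
  · simp [← h]
  · exact ENNReal.ofReal_le_ofReal ((Real.log_le_iff_le_exp h).2 (hfH v hv))

theorem IsCompatible.apply_indicator_mul_truncOrd_le {Λ : (Z → ℝ) →ₗ[ℝ] ℝ}
    (hΛ : IsCompatible μ (Place.res K) Z Λ) {f : R}
    (hΛf : ∀ e ∈ baseDominated μ (Place.res K) Z, (∀ v : Z, v.1 f ≤ Real.exp (-e v)) → Λ e ≤ 0)
    {C : Set (Place K)} (hC : MeasurableSet C) (hμC : μ C ≠ ⊤)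
    (hZC : IsCompact (Z ∩ Place.res K ⁻¹' C)) {H : Place K → ℝ} (hH : Integrable H μ)
    (hfH : ∀ v ∈ Z, v f ≤ Real.exp (H (v.res K))) (N : ℕ) :
    Λ (fun v => C.indicator 1 (v.1.res K) * truncOrd f N v) ≤ ∫ p in Cᶜ, H p ∂μ := by
  obtain ⟨M, hM⟩ := hZC.exists_bound_of_continuousOn (continuous_truncOrd f N).continuousOn
  have cutoff_mem := indicator_mul_mem_baseDominated (Z := Z) (e := fun v => truncOrd f N v)
    hC hμC fun v hv => hM v ⟨v.2, hv⟩
  have hH_compl : Integrable (Cᶜ.indicator H) μ := hH.indicator hC.compl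
  rw [← integral_indicator hC.compl, ← hΛ.base _ hH_compl, ← sub_nonpos, ← map_sub]
  refine hΛf _ (Submodule.sub_mem _ cutoff_mem (comp_mem_baseDominated hH_compl)) fun v => ?_
  by_cases hv : v.1.res K ∈ C
  · simpa [hv] using apply_le_exp_neg_truncOrd f N v.1
  · simpa [hv] using hfH v v.2

theorem tendsto_setIntegral_compl {T : Type*} [MeasurableSpace T] {μ : Measure T} {C : ℕ → Set T}
    (hC : ∀ N, MeasurableSet (C N)) (hC_mono : Monotone C) (hcover : ∀ᵐ p ∂μ, ∃ N, p ∈ C N)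
    {H : T → ℝ} (hH : Integrable H μ) :
    Tendsto (fun N => ∫ p in (C N)ᶜ, H p ∂μ) atTop (𝓝 0) := by
  have h := Antitone.tendsto_setIntegral (fun N => (hC N).compl)
    (fun M N hMN => Set.compl_subset_compl.2 (hC_mono hMN)) hH.integrableOn
  have null : μ (⋂ N, (C N)ᶜ) = 0 :=
    measure_mono_null (t := {p | ¬∃ N, p ∈ C N})
      (fun p hp ⟨N, hN⟩ => Set.mem_iInter.1 hp N hN) (ae_iff.1 hcover)
  rwa [Measure.restrict_eq_zero.2 null, integral_zero_measure] at h

theorem ProductInequality.exists_measure [IsDomain R] [Countable K]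
    (hprod : ProductInequality μ Z) (hZ : MeasurableSet Z)
    (hbound : ∀ f : R, ∃ H : Place K → ℝ, Integrable H μ ∧
      ∀ v ∈ Z, v f ≤ Real.exp (H (v.res K)))
    {C : ℕ → Set (Place K)} (hC : ∀ j, MeasurableSet (C j)) (hC_mono : Monotone C)
    (hμC : ∀ j, μ (C j) ≠ ⊤) (hZC : ∀ j, IsCompact (Z ∩ Place.res K ⁻¹' C j))
    (hcover : ∀ᵐ p ∂μ, ∃ j, p ∈ C j) :
    ∃ ν : Measure (Place R), ν.map (Place.res K) = μ ∧ (∀ᵐ v ∂ν, v ∈ Z) ∧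
      ∀ f : R, f ≠ 0 → (∀ᵐ v ∂ν, v f ≠ 0) ∧ Integrable (fun v => Real.log (v f)) ν ∧
        0 ≤ ∫ v, Real.log (v f) ∂ν := by
  obtain ⟨Λ, hΛ, hΛ_nonpos⟩ := hprod.exists_isCompatible
  obtain ⟨ν, hνμ, hνZ, hν⟩ :=
    hΛ.exists_measure Place.continuous_res hZ hC hC_mono hμC hZC hcover
  refine ⟨ν, hνμ, hνZ, fun f hf => ?_⟩
  obtain ⟨H, hH, hfH⟩ := hbound f
  have log_lt_top := lintegral_ofReal_log_lt_top hνμ hνZ hH hfH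
  have cover : ∀ᵐ v ∂ν, ∃ N, v ∈ Place.res K ⁻¹' C N :=
    ae_of_ae_map Place.continuous_res.measurable.aemeasurable (hνμ ▸ hcover)
  have setLIntegral_le (N : ℕ) : ∫⁻ v in Place.res K ⁻¹' C N, ENNReal.ofReal (truncOrd f N v) ∂ν ≤
      ∫⁻ v, ENNReal.ofReal (Real.log (v f)) ∂ν + ENNReal.ofReal (∫ p in (C N)ᶜ, H p ∂μ) := by
    obtain ⟨integrable_truncOrd, integral_truncOrd⟩ := hν N _ (continuous_truncOrd f N)
    refine lintegral_ofReal_le_of_integral_le integrable_truncOrd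
      (integral_truncOrd.trans_le (hΛ.apply_indicator_mul_truncOrd_le (hΛ_nonpos f hf) (hC N)
        (hμC N) (hZC N) hH hfH N)) ?_
    exact (setLIntegral_le_lintegral _ _).trans
      (lintegral_mono fun v => ofReal_neg_truncOrd_le f N v)
  have iSup_le : ∫⁻ v, ⨆ N, ENNReal.ofReal (truncOrd f N v) ∂ν ≤
      ∫⁻ v, ENNReal.ofReal (Real.log (v f)) ∂ν :=
    lintegral_iSup_le_of_setLIntegral_le (fun N => Place.continuous_res.measurable (hC N))
      (fun _ _ h => Set.preimage_mono (hC_mono h)) cover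
      (fun N => (continuous_truncOrd f N).measurable.ennreal_ofReal)
      (fun _ _ h v => ENNReal.ofReal_le_ofReal (truncOrd_mono f v h))
      (by simpa using ENNReal.tendsto_ofReal (tendsto_setIntegral_compl hC hC_mono hcover hH))
      setLIntegral_le
  exact integrable_log_of_lintegral_iSup_truncOrd_le log_lt_top.ne iSup_le

end ProductInequality

section CompactCover

variable {T : Type*} [TopologicalSpace T] [T2Space T] [MeasurableSpace T] [OpensMeasurableSpace T]
  {μ : Measure T} [μ.InnerRegularCompactLTTop] {B : Set T}

theorem exists_isCompact_seq_measure_sdiff_iUnion_eq_zero (hB : MeasurableSet B) (hμB : μ B ≠ ⊤) :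
    ∃ C : ℕ → Set T, (∀ k, IsCompact (C k)) ∧ (∀ k, C k ⊆ B) ∧ μ (B \ ⋃ k, C k) = 0 := by
  choose C hCB hC hlt using fun k : ℕ => hB.exists_isCompact_sdiff_lt hμB
    (ENNReal.inv_ne_zero.2 (ENNReal.natCast_ne_top k))
  refine ⟨C, hC, hCB, nonpos_iff_eq_zero.1
    (ge_of_tendsto' ENNReal.tendsto_inv_nat_nhds_zero fun k => ?_)⟩
  exact (measure_mono (Set.sdiff_subset_sdiff_right (Set.subset_iUnion C k))).trans (hlt k).le

theorem exists_monotone_isCompact_ae_cover [SigmaFinite μ] (hB : MeasurableSet B) :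
    ∃ C : ℕ → Set T, Monotone C ∧ (∀ j, IsCompact (C j)) ∧ (∀ j, μ (C j) ≠ ⊤) ∧ (∀ j, C j ⊆ B) ∧
      ∀ᵐ p ∂μ, p ∈ B → ∃ j, p ∈ C j := by
  have piece_ne_top (i : ℕ) : μ (spanningSets μ i ∩ B) ≠ ⊤ :=
    ne_top_of_le_ne_top (measure_spanningSets_lt_top μ i).ne (measure_mono Set.inter_subset_left)
  choose C hC hCB hnull using fun i => exists_isCompact_seq_measure_sdiff_iUnion_eq_zero
    ((measurableSet_spanningSets μ i).inter hB) (piece_ne_top i)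
  let C' (j : ℕ) : Set T := C j.unpair.1 j.unpair.2
  refine ⟨Set.accumulate C', Set.monotone_accumulate, isCompact_accumulate fun j => hC _ _,
    fun j => ?_, fun j => Set.iUnion₂_subset fun i _ => (hCB _ _).trans Set.inter_subset_right, ?_⟩
  · exact (measure_biUnion_lt_top (Set.finite_Iic j) fun i _ =>
      (measure_mono (hCB _ _)).trans_lt (piece_ne_top _).lt_top).ne
  · filter_upwards [ae_all_iff.2 fun i => measure_eq_zero_iff_ae_notMem.1 (hnull i)] with p hp hpB
    have p_mem := mem_spanningSetsIndex μ p
    have p_mem_iUnion := not_not.1 (not_and.1 (hp _) ⟨p_mem, hpB⟩)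
    rw [← Set.mem_iUnion, Set.iUnion_accumulate, Set.iUnion_unpair]
    exact Set.mem_iUnion_of_mem _ p_mem_iUnion

end CompactCover

namespace Place

variable {K : Type*} [Field K] {a : K}

theorem continuous_val (ha : a ≠ 0) : Continuous fun v : Place K => v.val a :=
  ((continuous_eval a).log fun v => (v.pos_of_ne_zero ha).ne').neg

theorem exists_val_ne_zero {v : Place K} (hv : ¬ v.IsTrivial) : ∃ a ≠ 0, v.val a ≠ 0 := by
  obtain ⟨a, ha, one_lt⟩ := exists_one_lt_of_not_isTrivial hv
  exact ⟨a, ha, (v.val_ne_zero_iff ha).2 one_lt.ne'⟩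

end Place

namespace GVF

variable {K : Type*} [Field K] (G : GVF K)

theorem sigmaFinite [Countable K] : SigmaFinite G.measure := by
  refine Measure.sigmaFinite_of_countable (S := {G.repsᶜ} ∪
      Set.range fun q : {a : K // a ≠ 0} × ℕ => {v | 1 / ((q.2 : ℝ) + 1) < ‖v.val q.1.1‖})
    ((Set.countable_singleton _).union (Set.countable_range _)) ?_ ?_
  · rintro s (rfl | ⟨⟨⟨a, ha⟩, k⟩, rfl⟩)
    · rw [G.concentrated]
      exact ENNReal.zero_lt_top
    · exact (G.integrable a ha).measure_norm_gt_lt_top Nat.one_div_pos_of_nat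
  · refine Set.eq_univ_of_forall fun v => ?_
    by_cases hv : v ∈ G.reps
    · obtain ⟨a, ha, h⟩ := Place.exists_val_ne_zero (G.nontrivial v hv)
      obtain ⟨k, hk⟩ := exists_nat_one_div_lt (norm_pos_iff.2 h)
      exact Set.mem_sUnion.2 ⟨_, Or.inr ⟨⟨⟨a, ha⟩, k⟩, rfl⟩, hk⟩
    · exact Set.mem_sUnion.2 ⟨_, Or.inl rfl, hv⟩

theorem measure_lt_top_of_isCompact {S : Set (Place K)} (hS : IsCompact S) (hSG : S ⊆ G.reps) :
    G.measure S < ⊤ := by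
  refine hS.measure_lt_top_of_nhdsWithin fun p hp => ?_
  obtain ⟨a, ha, h⟩ := Place.exists_val_ne_zero (G.nontrivial p (hSG hp))
  have norm_pos : 0 < ‖p.val a‖ := norm_pos_iff.2 h
  refine ⟨{v | ‖p.val a‖ / 2 < ‖v.val a‖}, mem_nhdsWithin_of_mem_nhds ?_,
    (G.integrable a ha).measure_norm_gt_lt_top (half_pos norm_pos)⟩
  exact (Place.continuous_val ha).norm.continuousAt.eventually (lt_mem_nhds (half_lt_self norm_pos))

end GVF

section Bounds

variable {K R : Type*} [Field K] [CommRing R] [Algebra K R] {P : (Place K → ℝ) → Prop}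
  {Z : Set (Place R)} {f g : R}

/-- On `Z` the values `v f` are dominated by the exponential of a function on the base that lies in
the class `P` (integrable functions, or constants). The `max` makes all such functions nonnegative
at the places in question. -/
def Place.IsBoundedBy (P : (Place K → ℝ) → Prop) (Z : Set (Place R)) (f : R) : Prop :=
  ∃ H, P H ∧ ∀ v ∈ Z, max 1 (v f) ≤ Real.exp (H (v.res K))

namespace Place.IsBoundedBy

theorem mul (hP : ∀ H H', P H → P H' → P (H + H')) (hf : IsBoundedBy P Z f)
    (hg : IsBoundedBy P Z g) : IsBoundedBy P Z (f * g) := by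
  obtain ⟨H, hH, hfH⟩ := hf
  obtain ⟨H', hH', hgH'⟩ := hg
  refine ⟨H + H', hP _ _ hH hH', fun v hv => ?_⟩
  rw [Pi.add_apply, Real.exp_add, v.mul]
  have max_nonneg {r : ℝ} : 0 ≤ max 1 r := le_max_of_le_left zero_le_one
  refine (max_le ?_ ?_).trans (mul_le_mul (hfH v hv) (hgH' v hv) max_nonneg (Real.exp_pos _).le)
  · exact one_le_mul_of_one_le_of_one_le (le_max_left _ _) (le_max_left _ _)
  · exact mul_le_mul (le_max_right _ _) (le_max_right _ _) (v.nonneg g) max_nonneg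

theorem add (hP : ∀ H H', P H → P H' → P (H + H')) (htwo : IsBoundedBy P Z 2)
    (hf : IsBoundedBy P Z f) (hg : IsBoundedBy P Z g) : IsBoundedBy P Z (f + g) := by
  obtain ⟨N, hN, htwoN⟩ := htwo
  obtain ⟨H, hH, hfH⟩ := hf
  obtain ⟨H', hH', hgH'⟩ := hg
  refine ⟨N + (H + H'), hP _ _ hN (hP _ _ hH hH'), fun v hv => ?_⟩
  rw [Pi.add_apply, Pi.add_apply, Real.exp_add, Real.exp_add]
  have one_le_H : 1 ≤ Real.exp (H (v.res K)) := le_of_max_le_left (hfH v hv)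
  have one_le_H' : 1 ≤ Real.exp (H' (v.res K)) := le_of_max_le_left (hgH' v hv)
  have apply_two_le : max 1 (v 2) ≤ Real.exp (N (v.res K)) := htwoN v hv
  have max_apply_le : max (v f) (v g) ≤ Real.exp (H (v.res K)) * Real.exp (H' (v.res K)) :=
    max_le
      ((le_of_max_le_right (hfH v hv)).trans (le_mul_of_one_le_right (Real.exp_pos _).le one_le_H'))
      ((le_of_max_le_right (hgH' v hv)).trans (le_mul_of_one_le_left (Real.exp_pos _).le one_le_H))
  refine max_le (one_le_mul_of_one_le_of_one_le (le_of_max_le_left apply_two_le)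
    (one_le_mul_of_one_le_of_one_le one_le_H one_le_H'))
    ((v.add_le_max_one_two_mul_max f g).trans ?_)
  exact mul_le_mul apply_two_le max_apply_le (le_max_of_le_left (v.nonneg f)) (Real.exp_pos _).le

theorem of_mem_adjoin (hP : ∀ H H', P H → P H' → P (H + H'))
    (hK : ∀ a : K, IsBoundedBy P Z (algebraMap K R a)) {s : Set R}
    (hs : ∀ f ∈ s, IsBoundedBy P Z f) (hf : f ∈ Algebra.adjoin K s) : IsBoundedBy P Z f := by
  have htwo : IsBoundedBy P Z 2 := map_ofNat (algebraMap K R) 2 ▸ hK 2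
  induction hf using Algebra.adjoin_induction with
  | mem f hf => exact hs f hf
  | algebraMap a => exact hK a
  | add f g _ _ hf hg => exact IsBoundedBy.add hP htwo hf hg
  | mul f g _ _ hf hg => exact IsBoundedBy.mul hP hf hg

end Place.IsBoundedBy

theorem Place.isBoundedBy_const_of_isCompact {C : Set (Place K)} (hC : IsCompact C)
    (hZC : ∀ v ∈ Z, v.res K ∈ C) (a : K) :
    Place.IsBoundedBy (fun H : Place K → ℝ => ∃ M : ℝ, H = fun _ => M) Z (algebraMap K R a) := by
  obtain ⟨M, hM⟩ := hC.exists_bound_of_continuousOn (Place.continuous_eval a).continuousOn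
  refine ⟨_, ⟨Real.log (max 1 M), rfl⟩, fun v hv => ?_⟩
  rw [Real.exp_log (lt_max_of_lt_left one_pos)]
  exact max_le_max le_rfl ((le_abs_self _).trans (hM _ (hZC v hv)))

theorem GVF.isBoundedBy_integrable (G : GVF K) (a : K) :
    Place.IsBoundedBy (Integrable · G.measure) Z (algebraMap K R a) := by
  rcases eq_or_ne a 0 with rfl | ha
  · exact ⟨0, integrable_zero _ _ _, fun v _ => by simp [v.zero]⟩
  · refine ⟨fun p => |p.val a|, (G.integrable a ha).abs, fun v _ => ?_⟩
    refine max_le (Real.one_le_exp_iff.2 (abs_nonneg _)) ?_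
    refine (Real.log_le_iff_le_exp ((v.res K).pos_of_ne_zero ha)).1 ?_
    exact (le_abs_self _).trans_eq (abs_neg _).symm

end Bounds

section AdelicPoints

variable {K F : Type*} [Field K] [Field F] [Algebra K F] {n : ℕ} {G : GVF K}
  {x : Fin (n + 1) → F} {S : Set (Place K)} {A : Set (Place (affRing K x))}

theorem adjoin_range_affCoord (K : Type*) [Field K] [Algebra K F] (x : Fin (n + 1) → F) :
    Algebra.adjoin K (Set.range (affCoord K x)) = ⊤ := by
  rw [← Algebra.adjoin_adjoin_coe_preimage (s := Set.range x)]
  congr 1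
  ext f
  simp only [Set.mem_range, Set.mem_preimage, affCoord, Subtype.ext_iff]

theorem isBoundedBy_affRing {P : (Place K → ℝ) → Prop} {Z : Set (Place (affRing K x))}
    (hP : ∀ H H', P H → P H' → P (H + H'))
    (hK : ∀ a : K, Place.IsBoundedBy P Z (algebraMap K (affRing K x) a))
    (hx : ∀ i, Place.IsBoundedBy P Z (affCoord K x i)) (f : affRing K x) :
    Place.IsBoundedBy P Z f :=
  .of_mem_adjoin hP hK (Set.forall_mem_range.2 hx) (adjoin_range_affCoord K x ▸ Algebra.mem_top)

theorem Place.apply_le_one_of_res_isTrivial {v : Place (affRing K x)} (hv : (v.res K).IsTrivial)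
    (hx : ∀ i, v (affCoord K x i) ≤ 1) (f : affRing K x) : v f ≤ 1 := by
  have isBoundedBy_of_le {g : affRing K x} (hg : v g ≤ 1) : IsBoundedBy (K := K) (· = 0) {v} g :=
    ⟨0, rfl, fun w hw => by
      rw [Pi.zero_apply, Real.exp_zero, Set.mem_singleton_iff.1 hw]
      exact max_le le_rfl hg⟩
  have apply_le_one (a : K) : v.res K a ≤ 1 := by
    rcases eq_or_ne a 0 with rfl | ha
    · exact (v.res K).zero.trans_le zero_le_one
    · exact (hv a ha).le
  obtain ⟨_, rfl, hle⟩ := isBoundedBy_affRing (P := (· = 0)) (Z := {v})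
    (by rintro _ _ rfl rfl; exact add_zero 0) (fun a => isBoundedBy_of_le (apply_le_one a))
    (fun i => isBoundedBy_of_le (hx i)) f
  exact (le_of_max_le_right (hle v rfl)).trans_eq Real.exp_zero

/-- The union of the fibres `A_p` over all `p`. -/
def adelicPoints (x : Fin (n + 1) → F) (S : Set (Place K)) (A : Set (Place (affRing K x))) :
    Set (Place (affRing K x)) :=
  {v | v ∈ adelicFibre x S A (v.res K)}

theorem mem_adelicPoints {v : Place (affRing K x)} : v ∈ adelicPoints x S A ↔
    (v.res K ∈ S → v ∈ A) ∧ (v.res K ∉ S → ∀ i, v (affCoord K x i) ≤ 1) := by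
  change v ∈ adelicFibre x S A (v.res K) ↔ _
  unfold adelicFibre
  split_ifs with h <;> simp [h]

theorem mem_adelicFibre {v : Place (affRing K x)} {p : Place K} :
    v ∈ adelicFibre x S A p ↔ v.res K = p ∧ v ∈ adelicPoints x S A := by
  have res_eq : v ∈ adelicFibre x S A p → v.res K = p := by
    unfold adelicFibre
    split_ifs
    exacts [And.right, And.left]
  refine ⟨fun hv => ?_, fun ⟨h, hv⟩ => h ▸ hv⟩
  obtain rfl := res_eq hv
  exact ⟨rfl, hv⟩

theorem isClosed_setOf_forall_affCoord_le_one :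
    IsClosed {v : Place (affRing K x) | ∀ i, v (affCoord K x i) ≤ 1} := by
  rw [Set.ofPred_forall]
  exact isClosed_iInter fun i => isClosed_le (Place.continuous_eval _) continuous_const

theorem isCompact_adelicPoints_inter {C : Set (Place K)} (hC : IsCompact C) (hCS : C ⊆ Sᶜ) :
    IsCompact (adelicPoints x S A ∩ Place.res K ⁻¹' C) := by
  have eq_inter : adelicPoints x S A ∩ Place.res K ⁻¹' C =
      {v | ∀ i, v (affCoord K x i) ≤ 1} ∩ Place.res K ⁻¹' C := by
    ext v
    refine and_congr_left fun hv => mem_adelicPoints.trans ?_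
    have res_notMem : v.res K ∉ S := hCS hv
    simp only [res_notMem, false_imp_iff, true_and, not_false_eq_true, true_imp_iff,
      Set.mem_ofPred_eq]
  rw [eq_inter]
  refine Place.isCompact_of_isClosed_of_bounded (isClosed_setOf_forall_affCoord_le_one.inter
    (hC.isClosed.preimage Place.continuous_res)) fun f => ?_
  obtain ⟨_, ⟨M, rfl⟩, hM⟩ := isBoundedBy_affRing
    (Z := {v | ∀ i, v (affCoord K x i) ≤ 1} ∩ Place.res K ⁻¹' C)
    (by rintro _ _ ⟨M, rfl⟩ ⟨M', rfl⟩; exact ⟨M + M', rfl⟩)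
    (Place.isBoundedBy_const_of_isCompact hC fun v hv => hv.2)
    (fun i => ⟨_, ⟨0, rfl⟩, fun v hv => (max_le le_rfl (hv.1 i)).trans_eq Real.exp_zero.symm⟩) f
  exact ⟨Real.exp M, fun v hv => le_of_max_le_right (hM v hv)⟩

namespace IsAdelicSet

theorem adelicPoints_eq (hA : IsAdelicSet G x S A) : adelicPoints x S A =
    A ∪ ({v | ∀ i, v (affCoord K x i) ≤ 1} ∩ Place.res K ⁻¹' Sᶜ) := by
  ext v
  rw [mem_adelicPoints]
  by_cases h : v.res K ∈ S
  · simp [h]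
  · have notMem : v ∉ A := fun hv => h (hA.above v hv)
    simp [h, notMem]

theorem measurableSet_adelicPoints (hA : IsAdelicSet G x S A) :
    MeasurableSet (adelicPoints x S A) := by
  rw [hA.adelicPoints_eq]
  exact hA.isCompact.measurableSet.union (isClosed_setOf_forall_affCoord_le_one.measurableSet.inter
    (Place.continuous_res.measurable hA.isCompact_base.measurableSet.compl))

theorem inter_preimage_base (hA : IsAdelicSet G x S A) :
    adelicPoints x S A ∩ Place.res K ⁻¹' S = A := by
  ext v
  rw [Set.mem_inter_iff, mem_adelicPoints]
  exact ⟨fun h => h.1.1 h.2, fun h => ⟨⟨fun _ => h, fun h' => (h' (hA.above v h)).elim⟩,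
    hA.above v h⟩⟩

theorem measure_base_ne_top (hA : IsAdelicSet G x S A) : G.measure S ≠ ⊤ :=
  (G.measure_lt_top_of_isCompact hA.isCompact_base hA.base_subset).ne

theorem exists_monotone_cover [Countable K] (hA : IsAdelicSet G x S A) :
    ∃ C : ℕ → Set (Place K), Monotone C ∧ (∀ j, MeasurableSet (C j)) ∧
      (∀ j, G.measure (C j) ≠ ⊤) ∧
      (∀ j, IsCompact (adelicPoints x S A ∩ Place.res K ⁻¹' C j)) ∧
      ∀ᵐ p ∂G.measure, ∃ j, p ∈ C j := by
  have := G.sigmaFinite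
  have measurableSet_base := hA.isCompact_base.measurableSet
  obtain ⟨C, hC_mono, hC, hμC, hCS, hcover⟩ :=
    exists_monotone_isCompact_ae_cover (μ := G.measure) measurableSet_base.compl
  refine ⟨fun j => S ∪ C j, fun i j hij => Set.union_subset_union_right S (hC_mono hij),
    fun j => measurableSet_base.union (hC j).measurableSet,
    fun j => measure_union_ne_top hA.measure_base_ne_top (hμC j), fun j => ?_, ?_⟩
  · rw [Set.preimage_union, Set.inter_union_distrib_left, hA.inter_preimage_base]
    exact hA.isCompact.union (isCompact_adelicPoints_inter (hC j) (hCS j))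
  · filter_upwards [hcover] with p hp
    by_cases hpS : p ∈ S
    · exact ⟨0, Or.inl hpS⟩
    · exact (hp hpS).imp fun _ => Or.inr

theorem exists_integrable_bound (hA : IsAdelicSet G x S A) (f : affRing K x) :
    ∃ H : Place K → ℝ, Integrable H G.measure ∧
      ∀ v ∈ adelicPoints x S A, v f ≤ Real.exp (H (v.res K)) := by
  have isBoundedBy_affCoord (i : Fin (n + 1)) :
      Place.IsBoundedBy (Integrable · G.measure) (adelicPoints x S A) (affCoord K x i) := by
    obtain ⟨M, hM⟩ := hA.isCompact.exists_bound_of_continuousOn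
      (Place.continuous_eval (affCoord K x i)).continuousOn
    refine ⟨S.indicator fun _ => Real.log (max 1 M),
      (integrable_indicator_iff hA.isCompact_base.measurableSet).2
        (integrableOn_const hA.measure_base_ne_top), fun v hv => ?_⟩
    obtain ⟨mem_above, le_one_outside⟩ := mem_adelicPoints.1 hv
    by_cases h : v.res K ∈ S
    · rw [Set.indicator_of_mem h, Real.exp_log (lt_max_of_lt_left one_pos)]
      exact max_le_max le_rfl ((le_abs_self _).trans (hM v (mem_above h)))
    · rw [Set.indicator_of_notMem h, Real.exp_zero]
      exact max_le le_rfl (le_one_outside h i)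
  obtain ⟨H, hH, hle⟩ := isBoundedBy_affRing (fun _ _ => Integrable.add) G.isBoundedBy_integrable
    isBoundedBy_affCoord f
  exact ⟨H, hH, fun v hv => le_of_max_le_right (hle v hv)⟩

end IsAdelicSet

end AdelicPoints

section ExtendedIntegral

variable {α β : Type*} [MeasurableSpace α] [MeasurableSpace β] {μ : Measure α}

theorem eintegral_mono_ae {g g' : α → EReal} (h : ∀ᵐ a ∂μ, g a ≤ g' a) :
    eintegral μ g ≤ eintegral μ g' := by
  refine EReal.sub_le_sub (EReal.coe_ennreal_le_coe_ennreal_iff.2 (lintegral_mono_ae ?_))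
    (EReal.coe_ennreal_le_coe_ennreal_iff.2 (lintegral_mono_ae ?_))
  · exact h.mono fun a => EReal.toENNReal_le_toENNReal
  · exact h.mono fun a ha => EReal.toENNReal_le_toENNReal (EReal.neg_le_neg_iff.2 ha)

theorem eintegral_coe {h : α → ℝ} (hh : Integrable h μ) :
    eintegral μ (fun a => (h a : EReal)) = ((∫ a, h a ∂μ : ℝ) : EReal) := by
  rw [integral_eq_lintegral_pos_part_sub_lintegral_neg_part hh, EReal.coe_sub,
    EReal.coe_ennreal_toReal hh.lintegral_lt_top.ne,
    EReal.coe_ennreal_toReal (by exact hh.neg.lintegral_lt_top.ne)]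
  rfl

theorem eintegral_map {π : α → β} (hπ : AEMeasurable π μ) {g : β → EReal}
    (hg : AEMeasurable g (μ.map π)) : eintegral (μ.map π) g = eintegral μ (g ∘ π) := by
  have hg_neg : AEMeasurable (fun b => -g b) (μ.map π) := measurable_neg.comp_aemeasurable hg
  rw [eintegral, lintegral_map' hg.ereal_toENNReal hπ, lintegral_map' hg_neg.ereal_toENNReal hπ]
  rfl

end ExtendedIntegral

namespace Place

variable {R : Type*} [CommRing R]

theorem coe_le_ord {v : Place R} {f : R} {h : ℝ} (hv : v f ≤ Real.exp (-h)) :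
    (h : EReal) ≤ v.ord f := by
  rw [ord, EReal.le_neg, ← EReal.coe_neg, ← Real.log_exp (-h),
    ← ENNReal.log_ofReal_of_pos (Real.exp_pos _)]
  exact ENNReal.log_le_log_iff.2 (ENNReal.ofReal_le_ofReal hv)

theorem ord_eq_val {F : Type*} [Field F] (v : Place F) {f : F} (hf : f ≠ 0) :
    v.ord f = (v.val f : EReal) := by
  rw [ord, ENNReal.log_ofReal_of_pos (v.pos_of_ne_zero hf), val, EReal.coe_neg]

theorem continuous_ord (f : R) : Continuous fun v : Place R => v.ord f :=
  (ENNReal.continuous_log.comp (ENNReal.continuous_ofReal.comp (continuous_eval f))).neg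

end Place

section GlobalSections

variable {K F : Type*} [Field K] [Field F] [Algebra K F] {n : ℕ} {x : Fin (n + 1) → F}

theorem mul_mem_globalSections {f g : F} {m m' : ℕ} (hf : f ∈ globalSections K x m)
    (hg : g ∈ globalSections K x m') : f * g ∈ globalSections K x (m + m') := fun i hi => by
  rw [pow_add, mul_div_mul_comm]
  exact mul_mem (hf i hi) (hg i hi)

theorem algebraMap_mem_globalSections (hx : x 0 = 1) (a : K) (m : ℕ) :
    algebraMap K F a ∈ globalSections K x m := fun i _ => by
  have one_div_mem : 1 / x i ∈ Algebra.adjoin K (Set.range fun j => x j / x i) :=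
    Algebra.subset_adjoin ⟨0, by simp only [hx]⟩
  rw [← mul_one_div, ← one_div_pow]
  exact mul_mem (Subalgebra.algebraMap_mem _ a) (pow_mem one_div_mem m)

theorem pow_mem_globalSections {f : F} {m : ℕ} (hf : f ∈ globalSections K x m) (k : ℕ) :
    f ^ k ∈ globalSections K x (k * m) := fun i hi => by
  rw [mul_comm, pow_mul, ← div_pow]
  exact pow_mem (hf i hi) k

theorem globalSections_mono (hx : x 0 = 1) {m m' : ℕ} (h : m ≤ m') :
    globalSections K x m ⊆ globalSections K x m' := fun f hf => by
  obtain ⟨k, rfl⟩ := Nat.exists_eq_add_of_le h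
  simpa only [map_one, mul_one] using
    mul_mem_globalSections hf (algebraMap_mem_globalSections (K := K) hx 1 k)

theorem exists_mem_globalSections (hx : x 0 = 1) {f : F} (hf : f ∈ affRing K x) :
    ∃ m, 0 < m ∧ f ∈ globalSections K x m := by
  induction hf using Algebra.adjoin_induction with
  | mem f hf =>
    refine ⟨1, one_pos, fun i _ => ?_⟩
    obtain ⟨j, rfl⟩ := hf
    rw [pow_one]
    exact Algebra.subset_adjoin ⟨j, rfl⟩
  | algebraMap a => exact ⟨1, one_pos, algebraMap_mem_globalSections hx a 1⟩
  | add f g _ _ hf hg =>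
    obtain ⟨m, hm, hf⟩ := hf
    obtain ⟨m', -, hg⟩ := hg
    refine ⟨m + m', Nat.add_pos_left hm m', fun i hi => ?_⟩
    rw [add_div]
    exact add_mem (globalSections_mono hx (Nat.le_add_right m m') hf i hi)
      (globalSections_mono hx (Nat.le_add_left m' m) hg i hi)
  | mul f g _ _ hf hg =>
    obtain ⟨m, hm, hf⟩ := hf
    obtain ⟨m', -, hg⟩ := hg
    exact ⟨m + m', Nat.add_pos_left hm m', mul_mem_globalSections hf hg⟩

end GlobalSections

section Chebyshev

variable {K F : Type*} [Field K] [Field F] [Algebra K F] {n : ℕ} {x : Fin (n + 1) → F}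
  {G : GVF K} {S : Set (Place K)} {A : Set (Place (affRing K x))}

theorem integral_le_chebyshevTerm {f : affRing K x} {m : ℕ} (hfm : (f : F) ∈ globalSections K x m)
    (hf : f ≠ 0) {h : Place K → ℝ} (hh : Integrable h G.measure)
    (hle : ∀ v ∈ adelicPoints x S A, v f ≤ Real.exp (-h (v.res K))) :
    ((∫ p, h p ∂G.measure : ℝ) : EReal) ≤ chebyshevTerm G x S A m := by
  refine le_iSup_of_le f (le_iSup₂_of_le hfm hf ?_)
  rw [← eintegral_coe hh]
  refine eintegral_mono_ae (Eventually.of_forall fun p => le_iInf₂ fun v hvp => ?_)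
  obtain ⟨rfl, hv⟩ := mem_adelicFibre.1 hvp
  exact Place.coe_le_ord (hle v hv)

theorem nat_mul_integral_le_chebyshevTerm {f : affRing K x} {m : ℕ}
    (hfm : (f : F) ∈ globalSections K x m) (hf : f ≠ 0) {h : Place K → ℝ}
    (hh : Integrable h G.measure) (hle : ∀ v ∈ adelicPoints x S A, v f ≤ Real.exp (-h (v.res K)))
    (k : ℕ) : ((k * ∫ p, h p ∂G.measure : ℝ) : EReal) ≤ chebyshevTerm G x S A (k * m) := by
  rw [← integral_const_mul]
  refine integral_le_chebyshevTerm (f := f ^ k) ?_ (pow_ne_zero k hf) (hh.const_mul _)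
    fun v hv => ?_
  · rw [Subalgebra.coe_pow]
    exact pow_mem_globalSections hfm k
  · rw [Place.map_pow, ← mul_neg, Real.exp_nat_mul]
    exact pow_le_pow_left₀ (v.nonneg f) (hle v hv) k

theorem integral_div_le_chebyshevTerm_div {f : affRing K x} {m : ℕ}
    (hfm : (f : F) ∈ globalSections K x m) (hf : f ≠ 0) {h : Place K → ℝ}
    (hh : Integrable h G.measure) (hle : ∀ v ∈ adelicPoints x S A, v f ≤ Real.exp (-h (v.res K)))
    {k : ℕ} (hk : 0 < k) : (((∫ p, h p ∂G.measure) / m : ℝ) : EReal) ≤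
      chebyshevTerm G x S A (k * m) / ((k * m : ℕ) : EReal) := by
  have k_ne_zero : (k : ℝ) ≠ 0 := Nat.cast_ne_zero.2 hk.ne'
  rw [← mul_div_mul_left _ (m : ℝ) k_ne_zero, ← Nat.cast_mul, EReal.coe_div, EReal.coe_natCast]
  exact EReal.div_le_div_right_of_nonneg (Nat.cast_nonneg' _)
    (nat_mul_integral_le_chebyshevTerm hfm hf hh hle k)

theorem productInequality_of_one_le_chebyshev (hx : x 0 = 1) (hCh : 1 ≤ chebyshev G x S A) :
    ProductInequality G.measure (adelicPoints x S A) := by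
  intro f hf h hh hle
  rw [chebyshev, EReal.one_le_exp_iff, EReal.le_neg, neg_zero] at hCh
  obtain ⟨m, hm, hfm⟩ := exists_mem_globalSections hx f.2
  have frequently_le : ∃ᶠ N in atTop, (((∫ p, h p ∂G.measure) / m : ℝ) : EReal) ≤
      chebyshevTerm G x S A N / (N : EReal) :=
    frequently_atTop.2 fun N => ⟨(N + 1) * m, N.le_succ.trans (Nat.le_mul_of_pos_right _ hm),
      integral_div_le_chebyshevTerm_div hfm hf hh hle N.succ_pos⟩
  have integral_div_nonpos : (∫ p, h p ∂G.measure) / m ≤ 0 :=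
    EReal.coe_nonpos.1 ((le_limsup_of_frequently_le frequently_le).trans hCh)
  exact le_of_not_gt fun integral_pos =>
    (div_pos integral_pos (Nat.cast_pos.2 hm)).not_ge integral_div_nonpos

theorem one_le_chebyshev_of_infIntegral_nonpos
    (h : ∀ f : affRing K x, f ≠ 0 → infIntegral G x S A f ≤ 0) : 1 ≤ chebyshev G x S A := by
  rw [chebyshev, EReal.one_le_exp_iff, EReal.le_neg, neg_zero]
  refine limsup_le_of_le (h := Eventually.of_forall fun m => ?_)
  exact EReal.div_nonpos_of_nonpos_of_nonneg
    (iSup_le fun f => iSup₂_le fun _ hf => h f hf) (Nat.cast_nonneg' m)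

theorem IsAdelicSet.aemeasurable_iInf_ord [Countable K] (hA : IsAdelicSet G x S A)
    (f : affRing K x) :
    AEMeasurable (fun p => ⨅ v ∈ adelicFibre x S A p, v.ord f) G.measure := by
  obtain ⟨C, -, hC, -, hCZ, hcover⟩ := hA.exists_monotone_cover
  rw [← Measure.restrict_eq_self_of_ae_mem (hcover.mono fun p => Set.mem_iUnion.2),
    aemeasurable_iUnion_iff]
  refine fun j => aemeasurable_restrict_of_measurable_subtype (hC j) (measurable_of_Iio fun t => ?_)
  -- The sublevel sets are countable unions of images of compact sets.
  have preimage_eq : (fun p : C j => ⨅ v ∈ adelicFibre x S A p, v.ord f) ⁻¹' Set.Iio t =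
      Subtype.val ⁻¹' ⋃ q : {q : ℚ // ((q : ℝ) : EReal) < t},
        Place.res K '' (adelicPoints x S A ∩ Place.res K ⁻¹' C j ∩
          {v | v.ord f ≤ ((q.1 : ℝ) : EReal)}) := by
    ext ⟨p, hp⟩
    simp only [Set.mem_preimage, Set.mem_Iio, iInf_lt_iff, Set.mem_iUnion, Set.mem_image,
      Set.mem_inter_iff, Set.mem_ofPred_eq, mem_adelicFibre]
    constructor
    · rintro ⟨v, ⟨rfl, hv⟩, hlt⟩
      obtain ⟨q, hq, hqt⟩ := EReal.lt_iff_exists_rat_btwn.1 hlt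
      exact ⟨⟨q, hqt⟩, v, ⟨⟨hv, hp⟩, hq.le⟩, rfl⟩
    · rintro ⟨⟨q, hqt⟩, v, ⟨⟨hv, -⟩, hle⟩, rfl⟩
      exact ⟨v, ⟨rfl, hv⟩, hle.trans_lt hqt⟩
  rw [preimage_eq]
  refine measurable_subtype_coe (.iUnion fun q => IsCompact.measurableSet ?_)
  exact ((hCZ j).inter_right (isClosed_le (Place.continuous_ord f) continuous_const)).image
    Place.continuous_res

end Chebyshev

section LocalHeight

variable {F : Type*} [Field F] {n : ℕ} (x : Fin (n + 1) → F)

theorem localHeight_nonneg (v : Place F) : 0 ≤ localHeight x v :=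
  Real.iSup_nonneg fun _ => Real.posLog_nonneg

theorem localHeight_eq_zero_iff {x : Fin (n + 1) → F} {v : Place F} :
    localHeight x v = 0 ↔ ∀ i, v (x i) ≤ 1 := by
  have posLog_eq_zero_iff (i : Fin (n + 1)) : Real.posLog (v (x i)) = 0 ↔ v (x i) ≤ 1 := by
    rw [Real.posLog_eq_zero_iff, abs_of_nonneg (v.nonneg _)]
  refine ⟨fun h i => (posLog_eq_zero_iff i).1 (le_antisymm ?_ Real.posLog_nonneg), fun h => ?_⟩
  · rw [← h]
    exact le_ciSup (f := fun i => Real.posLog (v (x i))) (Set.finite_range _).bddAbove i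
  · exact (iSup_congr fun i => (posLog_eq_zero_iff i).2 (h i)).trans ciSup_const

theorem measurable_localHeight : Measurable (localHeight x) :=
  .iSup fun i => measurable_const.max (Place.measurable_eval (x i)).log

theorem GVF.integrable_localHeight (G : GVF F) : Integrable (localHeight x) G.measure := by
  have integrable_abs_val (i : Fin (n + 1)) : Integrable (fun v => |v.val (x i)|) G.measure := by
    rcases eq_or_ne (x i) 0 with h | h
    · simp [h, Place.val, Place.zero]
    · exact (G.integrable _ h).abs
  refine (integrable_finsetSum Finset.univ fun i _ => integrable_abs_val i).mono'
    (measurable_localHeight x).aestronglyMeasurable (Eventually.of_forall fun v => ?_)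
  rw [Real.norm_of_nonneg (localHeight_nonneg x v)]
  refine ciSup_le fun i => le_trans (max_le (abs_nonneg _) ?_) (Finset.single_le_sum
    (f := fun i => |v.val (x i)|) (fun i _ => abs_nonneg _) (Finset.mem_univ i))
  exact (le_abs_self _).trans_eq (abs_neg _).symm

end LocalHeight

section AdelicType

variable {K F : Type*} [Field K] [Field F] [Algebra K F] {n : ℕ} {x : Fin (n + 1) → F}
  {G : GVF K} {G' : GVF F} {S : Set (Place K)} {A : Set (Place (affRing K x))}

theorem IsAdelicSet.mem_adelicType_iff (hA : IsAdelicSet G x S A) :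
    G' ∈ adelicType G x S A ↔ G'.Extends G ∧
      ∀ᵐ v ∂G'.measure, v.comap (algebraMap (affRing K x) F) ∈ adelicPoints x S A := by
  have integrable := G'.integrable_localHeight x
  have measurableSet_above : MeasurableSet {v : Place F | v.res K ∈ S} :=
    Place.continuous_res.measurable hA.isCompact_base.measurableSet
  have integral_eq_iff : ∫ v, localHeight x v ∂G'.measure =
      ∫ v in {v | v.res K ∈ S}, localHeight x v ∂G'.measure ↔
        ∀ᵐ v ∂G'.measure, v.res K ∉ S → ∀ i, v (x i) ≤ 1 := by
    rw [← integral_add_compl measurableSet_above integrable, add_eq_left,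
      setIntegral_eq_zero_iff_of_nonneg_ae (Eventually.of_forall (localHeight_nonneg x))
        integrable.integrableOn, EventuallyEq, ae_restrict_iff' measurableSet_above.compl]
    simp only [Pi.zero_apply, localHeight_eq_zero_iff]
    rfl
  refine and_congr_right fun _ => ?_
  rw [integral_eq_iff, ← Filter.eventually_and]
  exact eventually_congr (Eventually.of_forall fun v =>
    (mem_adelicPoints (v := v.comap (algebraMap (affRing K x) F))).symm)

variable [Countable K]

theorem Place.measurableSet_res_isTrivial : MeasurableSet {v : Place F | (v.res K).IsTrivial} := by
  have eq_iInter : {v : Place F | (v.res K).IsTrivial} =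
      ⋂ a : {a : K // a ≠ 0}, {v | v (algebraMap K F a) = 1} := by
    ext v
    simp only [Set.mem_iInter, Subtype.forall]
    rfl
  rw [eq_iInter]
  exact .iInter fun a => Place.measurable_eval _ (measurableSet_singleton 1)

theorem IsAdelicSet.infIntegral_le_setIntegral_val (hA : IsAdelicSet G x S A)
    (hG' : G' ∈ adelicType G x S A) {f : affRing K x} (hf : (f : F) ≠ 0) :
    infIntegral G x S A f ≤
      ((∫ v in {v | ¬ (v.res K).IsTrivial}, v.val (f : F) ∂G'.measure : ℝ) : EReal) := by
  obtain ⟨extends_base, mem_adelicPoints⟩ := hA.mem_adelicType_iff.1 hG'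
  have aemeasurable_iInf_ord := hA.aemeasurable_iInf_ord f
  rw [GVF.Extends] at extends_base
  rw [← eintegral_coe (G'.integrable _ hf).integrableOn, infIntegral]
  rw [← extends_base] at aemeasurable_iInf_ord ⊢
  rw [eintegral_map Place.continuous_res.measurable.aemeasurable aemeasurable_iInf_ord]
  refine eintegral_mono_ae (ae_restrict_of_ae (mem_adelicPoints.mono fun v hv => ?_))
  rw [← v.ord_eq_val hf]
  exact iInf₂_le (v.comap (algebraMap (affRing K x) F)) (mem_adelicFibre.2 ⟨rfl, hv⟩)

theorem IsAdelicSet.infIntegral_nonpos (hA : IsAdelicSet G x S A)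
    (hG' : G' ∈ adelicType G x S A) {f : affRing K x} (hf : f ≠ 0) :
    infIntegral G x S A f ≤ 0 := by
  have coe_ne_zero : (f : F) ≠ 0 := fun h => hf (Subtype.ext h)
  refine (hA.infIntegral_le_setIntegral_val hG' coe_ne_zero).trans (EReal.coe_nonpos.2 ?_)
  have measurableSet_nontrivial : MeasurableSet {v : Place F | ¬ (v.res K).IsTrivial} :=
    Place.measurableSet_res_isTrivial.compl
  have integral_compl_nonneg :
      0 ≤ ∫ v in {v | ¬ (v.res K).IsTrivial}ᶜ, v.val (f : F) ∂G'.measure := by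
    refine setIntegral_nonneg_of_ae_restrict ?_
    filter_upwards [ae_restrict_of_ae (hA.mem_adelicType_iff.1 hG').2,
      ae_restrict_mem measurableSet_nontrivial.compl] with v hv not_nontrivial
    have isTrivial : (v.res K).IsTrivial := not_not.1 not_nontrivial
    have res_notMem : v.res K ∉ S := fun h => G.nontrivial _ (hA.base_subset h) isTrivial
    exact v.val_nonneg_iff.2
      (Place.apply_le_one_of_res_isTrivial isTrivial ((mem_adelicPoints.1 hv).2 res_notMem) f)
  have integral_add := integral_add_compl measurableSet_nontrivial (G'.integrable _ coe_ne_zero)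
  rw [G'.product_formula _ coe_ne_zero] at integral_add
  linarith

end AdelicType

section FractionField

variable {R F : Type*} [CommRing R] [Field F] [Algebra R F] [IsFractionRing R F]

namespace Place

theorem comap_algebraMap_injective : Function.Injective (comap (algebraMap R F)) := fun v w h => by
  refine toFun_injective (funext fun z => ?_)
  obtain ⟨a, b, -, rfl⟩ := IsFractionRing.div_surjective R z
  have apply_eq (c : R) : v (algebraMap R F c) = w (algebraMap R F c) :=
    congrFun (congrArg toFun h) c
  rw [div_eq_mul_inv, v.mul, w.mul, v.map_inv, w.map_inv, apply_eq, apply_eq]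

theorem exists_monoidWithZeroHom_extension [Nontrivial R] (v : Place R)
    (hv : ∀ f, f ≠ 0 → v f ≠ 0) :
    ∃ t : F →*₀ ℝ, ∀ f : R, t (algebraMap R F f) = v f := by
  let φ : R →*₀ ℝ := ⟨⟨v, v.zero⟩, v.one, v.mul⟩
  have isUnit_apply (b : nonZeroDivisors R) : IsUnit (φ b) :=
    isUnit_iff_ne_zero.2 (hv b (nonZeroDivisors.ne_zero b.2))
  let L := IsLocalization.toLocalizationMap (nonZeroDivisors R) F
  exact ⟨L.lift₀ φ isUnit_apply, fun f => L.lift_eq isUnit_apply f⟩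

theorem exists_comap_algebraMap_eq [IsDomain R] (v : Place R) (hv : ∀ f, f ≠ 0 → v f ≠ 0) :
    ∃ w : Place F, w.comap (algebraMap R F) = v := by
  obtain ⟨t, t_algebraMap⟩ := v.exists_monoidWithZeroHom_extension (F := F) hv
  have t_nonneg (z : F) : 0 ≤ t z := by
    obtain ⟨a, b, -, rfl⟩ := IsFractionRing.div_surjective R z
    rw [map_div₀, t_algebraMap, t_algebraMap]
    exact div_nonneg (v.nonneg a) (v.nonneg b)
  refine ⟨⟨t, t_nonneg, map_zero t, map_one t, _root_.map_mul t, ?_⟩,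
    toFun_injective (funext t_algebraMap)⟩
  refine v.nonarch_or_arch.imp (fun nonarch y z => ?_) fun ⟨σ, c, hc, v_eq⟩ => ?_
  · obtain ⟨a, b, d, hy, hz⟩ := IsLocalization.surj₂ (nonZeroDivisors R) F y z
    have t_pos : 0 < t (algebraMap R F d) := by
      rw [t_algebraMap]
      exact (v.nonneg d).lt_of_ne' (hv d (nonZeroDivisors.ne_zero d.2))
    refine le_of_mul_le_mul_right ?_ t_pos
    change t (y + z) * _ ≤ max (t y) (t z) * _
    rw [max_mul_of_nonneg _ _ t_pos.le, ← _root_.map_mul, ← _root_.map_mul, ← _root_.map_mul,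
      add_mul, hy, hz, ← map_add, t_algebraMap, t_algebraMap, t_algebraMap]
    exact nonarch a b
  · have σ_injective : Function.Injective σ := (injective_iff_map_eq_zero σ).2 fun a ha => by
      by_contra a_ne_zero
      exact hv a a_ne_zero (by rw [v_eq, ha, norm_zero, Real.zero_rpow hc.ne'])
    refine ⟨IsFractionRing.lift σ_injective, c, hc, fun z => ?_⟩
    obtain ⟨a, b, -, rfl⟩ := IsFractionRing.div_surjective R z
    rw [map_div₀, map_div₀, t_algebraMap, t_algebraMap, IsFractionRing.lift_algebraMap,
      IsFractionRing.lift_algebraMap, norm_div, Real.div_rpow (norm_nonneg _) (norm_nonneg _),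
      v_eq, v_eq]

end Place

end FractionField

section Atoms

variable {F : Type*} [Field F] {ι : Type*} {w : ι → Place F} {c : ι → ℝ}

theorem IsKrullFamily.countable [Countable F] {B : Type*} [CommRing B] [Algebra B F]
    (hw : IsKrullFamily B w) (hw' : ∀ i, ¬ (w i).IsTrivial) : Countable ι := by
  refine Set.countable_univ_iff.1 (Set.Countable.mono (fun i _ => ?_)
    (Set.countable_iUnion fun f : {f : F // f ≠ 0} => (hw.finite_ne_one f f.2).countable))
  obtain ⟨f, hf, one_lt⟩ := Place.exists_one_lt_of_not_isTrivial (hw' i)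
  exact Set.mem_iUnion.2 ⟨⟨f, hf⟩, one_lt.ne'⟩

/-- The measure giving the places `w i` the masses `c i`. -/
noncomputable def weightedDirac (w : ι → Place F) (c : ι → ℝ) : Measure (Place F) :=
  Measure.sum fun i => ENNReal.ofReal (c i) • Measure.dirac (w i)

variable [Countable ι]

theorem ae_weightedDirac {P : Place F → Prop} (h : ∀ i, P (w i)) :
    ∀ᵐ v ∂weightedDirac w c, P v :=
  Measure.ae_sum_iff.2 fun i => Measure.ae_smul_measure (by rw [ae_dirac_eq]; exact h i) _

variable {f : F}

theorem integrable_val_weightedDirac (hf : (Function.support fun i => (w i).val f).Finite) :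
    Integrable (fun v => v.val f) (weightedDirac w c) := by
  refine integrable_sum_dirac (fun i => ENNReal.ofReal_ne_top)
    (summable_of_hasFiniteSupport (hf.subset fun i => mt fun h : (w i).val f = 0 => ?_))
  simp only [h, norm_zero, mul_zero]

theorem integral_val_weightedDirac (hc : ∀ i, 0 ≤ c i)
    (hf : (Function.support fun i => (w i).val f).Finite) :
    ∫ v, v.val f ∂weightedDirac w c = ∑ᶠ i, c i * (w i).val f := by
  rw [weightedDirac, integral_sum_dirac fun i => ENNReal.ofReal_ne_top]
  simp only [ENNReal.toReal_ofReal (hc _), smul_eq_mul]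
  exact tsum_eq_finsum (hf.subset (Function.support_mul_subset_right _ _))

end Atoms

section Extension

variable {K F : Type*} [Field K] [Field F] [Algebra K F]

namespace Place

variable {v u : Place F}

theorem Equivalent.res (h : v.Equivalent u) : (v.res K).Equivalent (u.res K) :=
  h.imp fun _ h => ⟨h.1, fun a => h.2 (algebraMap K F a)⟩

theorem Equivalent.isTrivial_iff (h : v.Equivalent u) : v.IsTrivial ↔ u.IsTrivial := by
  obtain ⟨s, hs, h⟩ := h
  refine forall₂_congr fun f hf => ?_
  rw [h, ← Real.rpow_left_inj (v.nonneg f) zero_le_one hs.ne', Real.one_rpow]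

theorem Equivalent.eq_of_res_eq (h : v.Equivalent u) (hres : v.res K = u.res K)
    (hv : ¬ (v.res K).IsTrivial) : v = u := by
  obtain ⟨s, -, h⟩ := h
  obtain ⟨a, -, one_lt⟩ := exists_one_lt_of_not_isTrivial hv
  have apply_eq : v (algebraMap K F a) = u (algebraMap K F a) := congrFun (congrArg toFun hres) a
  have s_eq_one : s = 1 := by
    rw [h, ← Real.rpow_one (v _), ← Real.rpow_mul (v.nonneg _), one_mul] at apply_eq
    exact ((Real.rpow_right_inj (zero_lt_one.trans one_lt) one_lt.ne').1 apply_eq).symm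
  exact toFun_injective (funext fun f => by rw [h, s_eq_one, Real.rpow_one])

theorem isTrivial_res_of_forall_le_one {R : Type*} [CommRing R] [Algebra K R] [Algebra R F]
    [IsScalarTower K R F] (hv : ∀ f : R, v (algebraMap R F f) ≤ 1) : (v.res K).IsTrivial :=
  have res_le_one (a : K) : v.res K a ≤ 1 := by
    change v (algebraMap K F a) ≤ 1
    rw [IsScalarTower.algebraMap_apply K R F]
    exact hv _
  fun a ha => eq_one_of_le_one_of_inv_le_one _ ha (res_le_one a) (res_le_one a⁻¹)

end Place

namespace GVF

variable (G : GVF K) {ν τ : Measure (Place F)} {ι : Type*} {w : ι → Place F}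

theorem eq_of_equivalent_of_mem_union (hw : Place.IsRepresentativeFamily w)
    (hwK : ∀ i, ((w i).res K).IsTrivial) {v u : Place F}
    (hv : v ∈ Place.res K ⁻¹' G.reps ∪ Set.range w)
    (hu : u ∈ Place.res K ⁻¹' G.reps ∪ Set.range w) (h : v.Equivalent u) : v = u := by
  rcases hv with hv | ⟨i, rfl⟩ <;> rcases hu with hu | ⟨j, rfl⟩
  · exact h.eq_of_res_eq (G.inequivalent _ hv _ hu h.res) (G.nontrivial _ hv)
  · exact absurd (h.res.isTrivial_iff.2 (hwK j)) (G.nontrivial _ hv)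
  · exact absurd (h.res.isTrivial_iff.1 (hwK i)) (G.nontrivial _ hu)
  · exact hw.eq_of_equivalent i j h

theorem ae_res_mem_reps (hν : ν.map (Place.res K) = G.measure) :
    ∀ᵐ v ∂ν, v.res K ∈ G.reps :=
  ae_of_ae_map Place.continuous_res.measurable.aemeasurable (hν ▸ mem_ae_iff.2 G.concentrated)

theorem exists_measure_eq_add [Countable ι] (hν : ν.map (Place.res K) = G.measure)
    (hw : Place.IsRepresentativeFamily w) (hwK : ∀ i, ((w i).res K).IsTrivial)
    (hτ : ∀ᵐ v ∂τ, v ∈ Set.range w)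
    (hint : ∀ f : F, f ≠ 0 → Integrable (fun v => v.val f) (ν + τ))
    (hprod : ∀ f : F, f ≠ 0 → ∫ v, v.val f ∂(ν + τ) = 0) :
    ∃ G' : GVF F, G'.measure = ν + τ := by
  refine ⟨⟨Place.res K ⁻¹' G.reps ∪ Set.range w,
    (Place.continuous_res.measurable G.measurableSet_reps).union
      (Set.countable_range w).measurableSet, ?_, fun v hv u hu h =>
      G.eq_of_equivalent_of_mem_union hw hwK hv hu h, ν + τ, ?_, hint, hprod⟩, rfl⟩
  · rintro v (hv | ⟨i, rfl⟩)
    · exact fun h => G.nontrivial _ hv fun a ha => h _ ((map_ne_zero _).2 ha)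
    · exact hw.nontrivial i
  · refine mem_ae_iff.1 (ae_add_measure_iff.2 ⟨?_, hτ.mono fun v hv => Or.inr hv⟩)
    exact (G.ae_res_mem_reps hν).mono fun v hv => Or.inl hv

theorem extends_of_measure_eq_add {G' : GVF F} (hG' : G'.measure = ν + τ)
    (hν : ν.map (Place.res K) = G.measure) (hτ : ∀ᵐ v ∂τ, (v.res K).IsTrivial) :
    G'.Extends G := by
  have restrict_ν : ν.restrict {v | ¬ (v.res K).IsTrivial} = ν :=
    Measure.restrict_eq_self_of_ae_mem
      ((G.ae_res_mem_reps hν).mono fun v hv => G.nontrivial _ hv)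
  have restrict_τ : τ.restrict {v | ¬ (v.res K).IsTrivial} = 0 := Measure.restrict_eq_zero.2 hτ
  rw [GVF.Extends, hG', Measure.restrict_add, restrict_ν, restrict_τ, add_zero, hν]

end GVF

section FractionField

variable {R : Type*} [CommRing R] [Algebra R F] [IsFractionRing R F]
  {ν : Measure (Place F)}

theorem exists_map_comap_algebraMap_eq [IsDomain R] [Countable R] [Countable F]
    {μ : Measure (Place R)} (hμ : ∀ f : R, f ≠ 0 → ∀ᵐ v ∂μ, v f ≠ 0) :
    ∃ ν : Measure (Place F), ν.map (Place.comap (algebraMap R F)) = μ := by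
  have embedding : MeasurableEmbedding (Place.comap (algebraMap R F)) :=
    (Place.continuous_comap _).measurableEmbedding Place.comap_algebraMap_injective
  refine ⟨μ.comap _, (embedding.map_comap μ).trans (Measure.restrict_eq_self_of_ae_mem ?_)⟩
  filter_upwards [ae_all_iff.2 fun f : {f : R // f ≠ 0} => hμ f f.2] with v hv
  exact v.exists_comap_algebraMap_eq fun f hf => hv ⟨f, hf⟩

theorem integrable_val_of_forall_algebraMap
    (hν : ∀ f : R, f ≠ 0 → Integrable (fun v => v.val (algebraMap R F f)) ν) {f : F}
    (hf : f ≠ 0) : Integrable (fun v => v.val f) ν := by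
  obtain ⟨a, b, -, rfl⟩ := IsFractionRing.div_surjective R f
  obtain ⟨ha, hb⟩ := div_ne_zero_iff.1 hf
  refine ((hν a (ne_zero_of_map ha)).sub (hν b (ne_zero_of_map hb))).congr
    (Eventually.of_forall fun v => ?_)
  change v.val (algebraMap R F a) - v.val (algebraMap R F b) = v.val (_ / _)
  rw [div_eq_mul_inv, v.isLogarithmic_val _ _ ha (inv_ne_zero hb), v.isLogarithmic_val.map_inv hb,
    sub_eq_add_neg]

theorem isLogarithmic_neg_integral_val (hν : ∀ f : F, f ≠ 0 → Integrable (fun v => v.val f) ν) :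
    IsLogarithmic fun f : F => -∫ v, v.val f ∂ν := fun f g hf hg => by
  simp only [fun v : Place F => v.isLogarithmic_val f g hf hg]
  rw [integral_add (hν f hf) (hν g hg), neg_add]

-- The defect of the product formula for `ν` is the integral against an effective divisor.
theorem GVF.exists_extends_measure_eq_add [IsDomain R] [Countable F] [Algebra K R]
    [Algebra.FiniteType K R] [IsScalarTower K R F] (G : GVF K)
    (hν : ν.map (Place.res K) = G.measure)
    (hint : ∀ f : F, f ≠ 0 → Integrable (fun v => v.val f) ν)
    (hnonpos : ∀ f : R, f ≠ 0 → ∫ v, v.val (algebraMap R F f) ∂ν ≤ 0) :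
    ∃ (G' : GVF F) (τ : Measure (Place F)), G'.measure = ν + τ ∧ G'.Extends G ∧
      ∀ᵐ v ∂τ, ∀ f : R, v (algebraMap R F f) ≤ 1 := by
  obtain ⟨ι, w, c, krull, reps, c_nonneg, neg_integral_eq⟩ := exists_divisorial_representation K
    (isLogarithmic_neg_integral_val hint) fun f hf => neg_nonneg.2 (hnonpos f hf)
  have : Countable ι := krull.countable reps.nontrivial
  have res_isTrivial (i : ι) : ((w i).res K).IsTrivial :=
    Place.isTrivial_res_of_forall_le_one (krull.le_one · i)
  obtain ⟨G', hG'⟩ := G.exists_measure_eq_add (τ := weightedDirac w c) hν reps res_isTrivial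
    (ae_weightedDirac Set.mem_range_self)
    (fun f hf => (hint f hf).add_measure
      (integrable_val_weightedDirac (krull.finite_support_val hf)))
    (fun f hf => by
      have integrable_τ := integrable_val_weightedDirac (c := c) (krull.finite_support_val hf)
      rw [integral_add_measure (hint f hf) integrable_τ,
        integral_val_weightedDirac c_nonneg (krull.finite_support_val hf), ← neg_integral_eq f hf,
        add_neg_cancel])
  exact ⟨G', _, hG', G.extends_of_measure_eq_add hG' hν (ae_weightedDirac res_isTrivial),
    ae_weightedDirac fun i f => krull.le_one f i⟩

end FractionField

end Extension

section Existence

variable {K F : Type*} [Field K] [Countable K] [Field F] [Algebra K F] {n : ℕ}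
  {x : Fin (n + 1) → F} {G : GVF K} {S : Set (Place K)} {A : Set (Place (affRing K x))}

theorem countable_affRing : Countable (affRing K x) := by
  rw [← Cardinal.mk_le_aleph0_iff, ← Cardinal.lift_le_aleph0]
  refine (Algebra.lift_cardinalMk_adjoin_le K (Set.range x)).trans (max_le (max_le ?_ ?_) le_rfl)
  · exact Cardinal.lift_le_aleph0.2 Cardinal.mk_le_aleph0
  · exact Cardinal.lift_le_aleph0.2 (Set.countable_range x).le_aleph0

theorem countable_of_isFractionRing_affRing [IsFractionRing (affRing K x) F] : Countable F := by
  have := countable_affRing (K := K) (x := x)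
  rw [← Cardinal.mk_le_aleph0_iff, IsFractionRing.cardinalMk (affRing K x) F]
  exact Cardinal.mk_le_aleph0

theorem IsAdelicSet.nonempty_adelicType [IsFractionRing (affRing K x) F] (hA : IsAdelicSet G x S A)
    (hx : x 0 = 1) (hCh : 1 ≤ chebyshev G x S A) : (adelicType G x S A).Nonempty := by
  have : Algebra.FiniteType K (affRing K x) := .adjoin_of_finite (Set.finite_range x)
  have := countable_affRing (K := K) (x := x)
  have := countable_of_isFractionRing_affRing (K := K) (x := x)
  obtain ⟨C, hC_mono, hC, hμC, hCZ, hcover⟩ := hA.exists_monotone_cover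
  obtain ⟨μ, hμ, μ_mem_adelicPoints, hμ_log⟩ :=
    (productInequality_of_one_le_chebyshev hx hCh).exists_measure hA.measurableSet_adelicPoints
      hA.exists_integrable_bound hC hC_mono hμC hCZ hcover
  obtain ⟨ν, rfl⟩ := exists_map_comap_algebraMap_eq (F := F) fun f hf => (hμ_log f hf).1
  have measurable_comap := (Place.continuous_comap (algebraMap (affRing K x) F)).measurable
  have map_res : ν.map (Place.res K) = G.measure := by
    rw [← hμ, Measure.map_map Place.continuous_res.measurable measurable_comap]
    rfl
  have integrable_algebraMap (f : affRing K x) (hf : f ≠ 0) :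
      Integrable (fun v => v.val (algebraMap (affRing K x) F f)) ν :=
    ((hμ_log f hf).2.1.comp_measurable measurable_comap).neg
  have integral_nonpos (f : affRing K x) (hf : f ≠ 0) :
      ∫ v, v.val (algebraMap (affRing K x) F f) ∂ν ≤ 0 := by
    have integral_log_nonneg := (hμ_log f hf).2.2
    rw [integral_map measurable_comap.aemeasurable
      (Place.measurable_eval f).log.aestronglyMeasurable] at integral_log_nonneg
    exact (integral_neg _).trans_le (neg_nonpos.2 integral_log_nonneg)
  obtain ⟨G', τ, hG', extends_base, le_one⟩ := G.exists_extends_measure_eq_add (R := affRing K x)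
    map_res (fun f hf => integrable_val_of_forall_algebraMap integrable_algebraMap hf)
    integral_nonpos
  refine ⟨G', hA.mem_adelicType_iff.2 ⟨extends_base, ?_⟩⟩
  rw [hG', ae_add_measure_iff]
  refine ⟨ae_of_ae_map measurable_comap.aemeasurable μ_mem_adelicPoints, le_one.mono fun v hv => ?_⟩
  have res_notMem : v.res K ∉ S := fun h =>
    G.nontrivial _ (hA.base_subset h) (Place.isTrivial_res_of_forall_le_one hv)
  exact mem_adelicPoints.2 ⟨fun h => absurd h res_notMem, fun _ i => hv (affCoord K x i)⟩

end Existence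

theorem mainTheorem8_general {K F : Type*} [Field K] [Countable K] [Field F] [Algebra K F] {n : ℕ}
    {x : Fin (n + 1) → F} [IsFractionRing (affRing K x) F] (hx : x 0 = 1) {G : GVF K}
    {S : Set (Place K)} {A : Set (Place (affRing K x))} (hA : IsAdelicSet G x S A) :
    (adelicType G x S A).Nonempty ↔ 1 ≤ chebyshev G x S A :=
  ⟨fun ⟨_, hG'⟩ => one_le_chebyshev_of_infIntegral_nonpos fun _ hf => hA.infIntegral_nonpos hG' hf,
    hA.nonempty_adelicType hx⟩

namespace ProjVariety

variable {K : Type*} [Field K] {n : ℕ} (X : ProjVariety K n)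

theorem coord_zero : X.coord 0 = 1 := Subtype.ext <| div_self <|
  (map_ne_zero_iff _ (IsFractionRing.injective X.HomCoordRing _)).2
    (mt Ideal.Quotient.eq_zero_iff_mem.1 X.X_zero_notMem)

theorem map_affRing_coord :
    (affRing K X.coord).map X.functionField.val = Algebra.adjoin K (Set.range X.ratio) := by
  rw [affRing, AlgHom.map_adjoin, ← Set.range_comp]
  rfl

theorem isFractionRing_affRing : IsFractionRing (affRing K X.coord) X.functionField :=
  IsFractionRing.of_field _ _ fun z => by
    obtain ⟨y, hy, y', hy', h⟩ := IntermediateField.mem_adjoin_iff_div.1 z.2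
    rw [← map_affRing_coord] at hy hy'
    obtain ⟨a, ha, rfl⟩ := hy
    obtain ⟨b, hb, rfl⟩ := hy'
    exact ⟨⟨a, ha⟩, ⟨b, hb⟩, Subtype.ext h⟩

end ProjVariety

theorem mainTheorem8 {K : Type*} [Field K] [Countable K] (G : GVF K) {n : ℕ}
    (X : ProjVariety K n) (S : Set (Place K)) (A : Set (Place (affRing K X.coord)))
    (hA : IsAdelicSet G X.coord S A) :
    (adelicType G X.coord S A).Nonempty ↔ 1 ≤ chebyshev G X.coord S A :=
  have := X.isFractionRing_affRing
  mainTheorem8_general X.coord_zero hA
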